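/- A pure cubic field is a field $K=\mathbb{Q}(\theta)$ of degree $3$ over $\mathbb{Q}$ with $\theta^3=m$ for some $m\in\mathbb{Z}$. Let $N$ be the Galois closure of such a $K$ over $\mathbb{Q}$ and let $K_2$ be the quadratic subfield of $N$ (here $K_2=\mathbb{Q}(\sqrt{-3})$). Then the conductor of the cyclic cubic extension $N/K_2$ is of the form $\mathfrak{f}(N/K_2)=f(K)\,\mathbb{Z}_{K_2}$ with a positive integer $f(K)$. For every $s\in\mathbb{C}$ with $\operatorname{Re}(s)>1$, $$\sum_{K}\frac{1}{f(K)^s}=-\frac12+\frac16\left(1+\frac{2}{3^s}+\frac{6}{3^{2s}}\right)\prod_{p\ne 3}\left(1+\frac{2}{p^s}\right)+\frac13\prod_{p\equiv\pm1\ (\mathrm{mod}\ 9)}\left(1+\frac{2}{p^s}\right)\prod_{p\not\equiv\pm1\ (\mathrm{mod}\ 9)}\left(1-\frac{1}{p^s}\right),$$ where $K$ runs over the pure cubic fields up to isomorphism, the products are over prime numbers $p$ (and $p\not\equiv\pm1\ (\mathrm{mod}\ 9)$ includes $p=3$), the series converges absolutely, and the products converge unconditionally. -/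

import Mathlib

open NumberField IsDedekindDomain

namespace PureCubic

/-- The `i`-th ramification group (lower numbering, `i ≥ 0`) of the prime `P` of `N` in the
Galois extension `N / F`: the `σ ∈ Gal(N/F)` with `σ x ≡ x (mod P ^ (i + 1))` for every
integer `x` of `N`. -/
def ramificationGroup (F N : Type*) [Field F] [Field N] [Algebra F N]
    (P : HeightOneSpectrum (𝓞 N)) (i : ℕ) : Subgroup (N ≃ₐ[F] N) :=
  (P.asIdeal ^ (i + 1)).inertia (N ≃ₐ[F] N)

open scoped Classical in
/-- The exponent of the conductor of the abelian extension `N / F` at the prime of `F` below `P`: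
`(1 / |G₀|) ∑ |G_i|`, the sum being over the `i ≥ 0` with `G_i ≠ 1`. It is `0` if `P` is unramified;
otherwise it is `φ(t) + 1`, where `t` is the last index with `G_t ≠ 1` and `φ` is Herbrand's
function. This is the Artin conductor exponent of a faithful character of the inertia group when
that group is cyclic; the division is exact by the theorem of Hasse and Arf. If `N / F` is cyclic
of prime degree, it is just the number of `i ≥ 0` with `G_i ≠ 1`. -/
noncomputable def conductorExponent (F N : Type*) [Field F] [Field N] [Algebra F N]
    (P : HeightOneSpectrum (𝓞 N)) : ℕ :=
  (∑ᶠ i : ℕ, if ramificationGroup F N P i = ⊥ then 0 else Nat.card (ramificationGroup F N P i)) /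
    Nat.card (ramificationGroup F N P 0)

/-- The ideal `𝔣` is the (finite part of the) conductor of the abelian extension `N / F` of number
fields: each prime of `F` divides `𝔣` exactly to the power prescribed by the ramification groups of
each of the primes of `N` above it. In particular `𝔣 ≠ 0`, since all multiplicities are finite. -/
def IsConductor (F N : Type*) [Field F] [Field N] [Algebra F N] (𝔣 : Ideal (𝓞 F)) : Prop :=
  ∀ P : HeightOneSpectrum (𝓞 N),
    emultiplicity (P.asIdeal.under (𝓞 F)) 𝔣 = conductorExponent F N P

/-- Let `N` be a Galois number field with a unique quadratic subfield `K₂` (the Galois closure of a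
noncyclic cubic field). The positive integer `f` satisfies `𝔣(N/K₂) = f ℤ_{K₂}`. -/
def IsResolventConductor (N : Type*) [Field N] [Algebra ℚ N] (f : ℕ) : Prop :=
  0 < f ∧ ∃ K₂ : IntermediateField ℚ N, Module.finrank ℚ K₂ = 2 ∧
    IsConductor K₂ N (Ideal.span {(f : 𝓞 K₂)})

/-- A pure cubic field: a cubic field `K = ℚ(θ)` with `θ ^ 3 = m` for some integer `m`. -/
def IsPureCubic (K : Type*) [Field K] [Algebra ℚ K] : Prop :=
  Module.finrank ℚ K = 3 ∧
    ∃ (m : ℤ) (θ : K), θ ^ 3 = (m : K) ∧ IntermediateField.adjoin ℚ {θ} = ⊤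

/-- The pure cubic fields inside a fixed algebraic closure of `ℚ`. -/
abbrev PureCubicField : Type :=
  {K : IntermediateField ℚ (AlgebraicClosure ℚ) // IsPureCubic K}

/-- The Galois closure of `K / ℚ`. -/
noncomputable abbrev galoisClosure (K : Type*) [Field K] [Algebra ℚ K] :
    IntermediateField ℚ (AlgebraicClosure ℚ) :=
  IntermediateField.normalClosure ℚ K (AlgebraicClosure ℚ)

/-- `f` is the positive integer with `𝔣(N/K₂) = f ℤ_{K₂}`, where `N` is the Galois closure of the
noncyclic cubic field `K` and `K₂` is the quadratic subfield of `N`. -/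
def IsCubicConductor (K : Type*) [Field K] [Algebra ℚ K] (f : ℕ) : Prop :=
  IsResolventConductor (galoisClosure K) f

/-- The integer `f(K)` of a noncyclic cubic field `K`. (The set has exactly one element; that it is
nonempty for pure cubic fields is part of the theorem.) -/
noncomputable def cubicConductor (K : Type*) [Field K] [Algebra ℚ K] : ℕ :=
  sInf {f : ℕ | IsCubicConductor K f}

/-- Isomorphism of pure cubic fields. -/
instance isoSetoid : Setoid PureCubicField where
  r K K' := Nonempty (K.1 ≃ₐ[ℚ] K'.1)
  iseqv := ⟨fun _ => ⟨AlgEquiv.refl⟩, fun ⟨e⟩ => ⟨e.symm⟩, fun ⟨e⟩ ⟨e'⟩ => ⟨e.trans e'⟩⟩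

/-- Isomorphism classes of pure cubic fields. -/
abbrev PureCubicClass : Type := Quotient isoSetoid

theorem galoisClosure_le {K K' : Type*} [Field K] [Algebra ℚ K] [Field K'] [Algebra ℚ K']
    (e : K ≃ₐ[ℚ] K') : galoisClosure K ≤ galoisClosure K' := by
  refine iSup_le fun f => ?_
  refine le_trans ?_ (AlgHom.fieldRange_le_normalClosure (f.comp e.symm.toAlgHom))
  rintro _ ⟨x, rfl⟩
  exact ⟨e x, by simp⟩

theorem galoisClosure_congr {K K' : Type*} [Field K] [Algebra ℚ K] [Field K'] [Algebra ℚ K']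
    (e : K ≃ₐ[ℚ] K') : galoisClosure K = galoisClosure K' :=
  le_antisymm (galoisClosure_le e) (galoisClosure_le e.symm)

theorem isCubicConductor_congr {K K' : Type*} [Field K] [Algebra ℚ K] [Field K'] [Algebra ℚ K']
    (e : K ≃ₐ[ℚ] K') (f : ℕ) : IsCubicConductor K f ↔ IsCubicConductor K' f := by
  have key : ∀ N N' : IntermediateField ℚ (AlgebraicClosure ℚ), N = N' →
      (IsResolventConductor N f ↔ IsResolventConductor N' f) := by
    rintro N _ rfl
    rfl
  exact key _ _ (galoisClosure_congr e)

/-- The integer `f(K)` of an isomorphism class of pure cubic fields. -/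
noncomputable def classConductor : PureCubicClass → ℕ :=
  Quotient.lift (fun K : PureCubicField => cubicConductor K.1) (by
    rintro K K' ⟨e⟩
    simp only [cubicConductor, isCubicConductor_congr e])

end PureCubic

/-! A pure cubic field is `ℚ(∛(ab²))` with `ab` squarefree and `(a, b) ≠ (1, 1)`. Only `(a, b)` and
`(b, a)` give isomorphic fields, so the sum over fields is half of a sum over pairs
(`exists_isRadicand_of_isPureCubic`, `card_radicandClass_fiber`).

The conductor comes from local Kummer theory over `ℚ(ω)`. In a totally ramified cubic extension the
exponent is the valuation of `τπ - π` for a uniformizer `π` (`conductorExponent_eq_of_val_eq`). This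
gives `1` at primes `p ≠ 3` dividing `ab`, and at the prime above `3` it gives `4`, `2` or `0`
according to whether `3 ∣ ab`, `3 ∤ ab` with `ab² ≢ ±1 (mod 9)`, or `ab² ≡ ±1 (mod 9)`. As `3` has
valuation `2` in `ℚ(ω)`, the conductor is `ab` if `ab² ≡ ±1 (mod 9)` and `3ab` otherwise
(`isConductor_radicandConductor`).

The condition modulo `9` is detected by the three characters of `(ℤ/9)ˣ/±1`. For a completely
multiplicative `c` bounded by `1`, the sum of `c(a) c(b)² (ab)^(-s)` over squarefree `ab` is the
Euler product with factors `1 + (c(p) + c(p)²) p^(-s)` (`hasProd_pairTerm`). The trivial characters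
give the first product of the formula; the two nontrivial cubic characters both give the second,
since `z + z² = -1`. Removing the pair `(1, 1)`, of conductor `1`, and halving gives the constant
`-1/2`. -/

namespace PureCubic

/-! ### Additive valuations at primes of a ring of integers. -/

section Valuation

variable {N : Type*} [Field N]

/-- The normalized additive valuation of an algebraic integer at a prime `P`. -/
noncomputable def val (P : HeightOneSpectrum (𝓞 N)) (x : 𝓞 N) : ℕ∞ :=
  emultiplicity P.asIdeal (Ideal.span {x})

theorem val_neg (P : HeightOneSpectrum (𝓞 N)) (x : 𝓞 N) : val P (-x) = val P x := by
  rw [val, Ideal.span_singleton_neg, val]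

variable [NumberField N]

theorem val_mul (P : HeightOneSpectrum (𝓞 N)) (x y : 𝓞 N) : val P (x * y) = val P x + val P y := by
  rw [val, ← Ideal.span_singleton_mul_span_singleton, emultiplicity_mul P.prime]
  rfl

theorem val_pow (P : HeightOneSpectrum (𝓞 N)) (x : 𝓞 N) (n : ℕ) : val P (x ^ n) = n * val P x := by
  rw [val, ← Ideal.span_singleton_pow, emultiplicity_pow P.prime]
  rfl

theorem mem_pow_iff_le_val (P : HeightOneSpectrum (𝓞 N)) (x : 𝓞 N) (n : ℕ) :
    x ∈ P.asIdeal ^ n ↔ (n : ℕ∞) ≤ val P x := by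
  rw [val, ← pow_dvd_iff_le_emultiplicity, Ideal.dvd_span_singleton]

theorem mem_iff_one_le_val (P : HeightOneSpectrum (𝓞 N)) (x : 𝓞 N) :
    x ∈ P.asIdeal ↔ 1 ≤ val P x := by
  simpa using mem_pow_iff_le_val P x 1

theorem val_eq_zero_iff (P : HeightOneSpectrum (𝓞 N)) (x : 𝓞 N) :
    val P x = 0 ↔ x ∉ P.asIdeal := by
  rw [mem_iff_one_le_val, Order.one_le_iff_ne_zero, not_not]

theorem exists_val_eq (P : HeightOneSpectrum (𝓞 N)) {x : 𝓞 N} (hx : x ≠ 0) :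
    ∃ n : ℕ, val P x = n := by
  have h : FiniteMultiplicity P.asIdeal (Ideal.span {x}) :=
    .of_prime_left P.prime (by simpa using hx)
  exact ⟨_, h.emultiplicity_eq_multiplicity⟩

theorem val_add_eq_of_lt (P : HeightOneSpectrum (𝓞 N)) {x y : 𝓞 N} (h : val P x < val P y) :
    val P (x + y) = val P x := by
  refine le_antisymm ?_ ?_ <;> refine ENat.forall_natCast_le_iff_le.1 fun n hn => ?_
  · by_contra! hlt
    have hle : ((n : ℕ∞)) ≤ val P (x + y) ∧ val P x + 1 ≤ n :=
      ⟨hn, Order.add_one_le_of_lt hlt⟩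
    obtain ⟨k, hk⟩ := ENat.ne_top_iff_exists.1 (ne_top_of_lt h)
    rw [← hk] at hlt h hle
    have hkn : k + 1 ≤ n := by exact_mod_cast hle.2
    have h1 : x + y ∈ P.asIdeal ^ (k + 1) :=
      Ideal.pow_le_pow_right hkn ((mem_pow_iff_le_val P _ n).2 hn)
    have h2 : y ∈ P.asIdeal ^ (k + 1) :=
      (mem_pow_iff_le_val P _ _).2 (by push_cast; exact Order.add_one_le_of_lt h)
    have h3 := (mem_pow_iff_le_val P _ _).1 ((add_mem_cancel_right h2).1 h1)
    rw [← hk] at h3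
    norm_cast at h3
    omega
  · rw [← mem_pow_iff_le_val] at hn ⊢
    exact add_mem hn
      ((mem_pow_iff_le_val P _ n).2 (((mem_pow_iff_le_val P _ n).1 hn).trans h.le))

variable {F : Type*} [Field F] [NumberField F] [Algebra F N]

theorem val_algebraMap (P : HeightOneSpectrum (𝓞 N)) {x : 𝓞 F} (hx : x ≠ 0) :
    val P (algebraMap (𝓞 F) (𝓞 N) x) =
      P.asIdeal.ramificationIdx (𝓞 F) * val (P.under (𝓞 F)) x := by
  have : P.asIdeal.LiesOver (P.under (𝓞 F)).asIdeal := ⟨rfl⟩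
  rw [val, ← Set.image_singleton, ← Ideal.map_span,
    Ideal.IsDedekindDomain.emultiplicity_map_eq_ramificationIdx'_mul (by simpa using hx)
      (P.under (𝓞 F)).irreducible P.irreducible P.ne_bot,
    Ideal.ramificationIdx'_eq_ramificationIdx _ _ (P.under (𝓞 F)).ne_bot]
  rfl

end Valuation

/-! ### Conductor exponents from the ramification filtration. -/

section Ramification

variable {F N : Type*} [Field F] [Field N] [Algebra F N]

theorem smul_algebraMap_ringOfIntegers (τ : N ≃ₐ[F] N) (c : 𝓞 F) :
    τ • algebraMap (𝓞 F) (𝓞 N) c = algebraMap (𝓞 F) (𝓞 N) c := by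
  ext
  exact τ.commutes (c : F)

/-- All nontrivial automorphisms leave the filtration at the same index, so each `G_i` is everything
or trivial and the sum is `n` copies of the group order. -/
theorem conductorExponent_eq [FiniteDimensional F N] [Nontrivial (N ≃ₐ[F] N)]
    {P : HeightOneSpectrum (𝓞 N)} {n : ℕ}
    (h : ∀ τ : N ≃ₐ[F] N, τ ≠ 1 → ∀ i, τ ∈ ramificationGroup F N P i ↔ i < n) :
    conductorExponent F N P = n := by
  classical
  have htop : ∀ i, i < n → ramificationGroup F N P i = ⊤ := fun i hi =>
    (Subgroup.eq_top_iff' _).2 fun τ => by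
      rcases eq_or_ne τ 1 with rfl | hτ
      · exact one_mem _
      · exact (h τ hτ i).2 hi
  have hbot : ∀ i, n ≤ i → ramificationGroup F N P i = ⊥ := fun i hi =>
    (Subgroup.eq_bot_iff_forall _).2 fun τ hm => by
      by_contra hτ
      exact absurd ((h τ hτ i).1 hm) (by omega)
  have hsum : (∑ᶠ i : ℕ, if ramificationGroup F N P i = ⊥ then 0
      else Nat.card (ramificationGroup F N P i)) = n * Nat.card (N ≃ₐ[F] N) := by
    rw [finsum_eq_sum_of_support_subset (s := Finset.range n)]
    · rw [Finset.sum_congr rfl (g := fun _ => Nat.card (N ≃ₐ[F] N))]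
      · simp
      · intro i hi
        rw [htop i (Finset.mem_range.1 hi), if_neg bot_ne_top.symm, Subgroup.card_top]
    · intro i hi
      by_contra hn
      exact hi (if_pos (hbot i (by simpa using hn)))
  rw [conductorExponent]
  refine Eq.trans (congrArg (· / _) (by convert hsum)) ?_
  rcases Nat.eq_zero_or_pos n with rfl | hn
  · simp
  · rw [htop 0 hn, Subgroup.card_top, Nat.mul_div_cancel _ Nat.card_pos]

/-- The preimage of `P` under `τ` is a prime with the same contraction to `F`, so it is `P`. -/
theorem smul_mem_pow_of_forall_under_eq {P : HeightOneSpectrum (𝓞 N)}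
    (huniq : ∀ Q : HeightOneSpectrum (𝓞 N), Q.under (𝓞 F) = P.under (𝓞 F) → Q = P)
    (τ : N ≃ₐ[F] N) {k : ℕ} {x : 𝓞 N} (hx : x ∈ P.asIdeal ^ k) : τ • x ∈ P.asIdeal ^ k := by
  let f : 𝓞 N →+* 𝓞 N := MulSemiringAction.toRingHom (N ≃ₐ[F] N) (𝓞 N) τ
  have hbot : P.asIdeal.comap f ≠ ⊥ := by
    obtain ⟨y, hy, hy0⟩ := Submodule.exists_mem_ne_zero_of_ne_bot P.ne_bot
    refine fun h => hy0 ?_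
    have : τ⁻¹ • y ∈ P.asIdeal.comap f := by
      rw [Ideal.mem_comap]
      simpa [f] using hy
    rw [h, Ideal.mem_bot] at this
    simpa using congrArg (τ • ·) this
  let Q : HeightOneSpectrum (𝓞 N) := ⟨P.asIdeal.comap f, inferInstance, hbot⟩
  have hQ : Q = P := by
    refine huniq Q (HeightOneSpectrum.ext ?_)
    ext c
    change τ • algebraMap (𝓞 F) (𝓞 N) c ∈ P.asIdeal ↔ algebraMap (𝓞 F) (𝓞 N) c ∈ P.asIdeal
    rw [smul_algebraMap_ringOfIntegers]
  rw [← hQ] at hx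
  exact Ideal.le_comap_pow f k hx

theorem conductorExponent_eq_zero [FiniteDimensional F N] [Nontrivial (N ≃ₐ[F] N)]
    {P : HeightOneSpectrum (𝓞 N)}
    (h : ∀ τ : N ≃ₐ[F] N, τ ≠ 1 → ∃ x : 𝓞 N, τ • x - x ∉ P.asIdeal) :
    conductorExponent F N P = 0 := by
  refine conductorExponent_eq fun τ hτ i => iff_of_false (fun hm => ?_) (Nat.not_lt_zero i)
  obtain ⟨x, hx⟩ := h τ hτ
  exact hx (Ideal.pow_le_self (Nat.succ_ne_zero i) (hm x))

variable [NumberField N]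

/-- In a totally ramified extension an automorphism acts trivially modulo `P ^ (i + 1)` as soon as
it fixes a uniformizer modulo `P ^ (i + 1)`. -/
theorem mem_ramificationGroup_iff {P : HeightOneSpectrum (𝓞 N)}
    (huniq : ∀ Q : HeightOneSpectrum (𝓞 N), Q.under (𝓞 F) = P.under (𝓞 F) → Q = P)
    (hres : ∀ x : 𝓞 N, ∃ c : 𝓞 F, x - algebraMap (𝓞 F) (𝓞 N) c ∈ P.asIdeal)
    {π : 𝓞 N} (hπ : val P π = 1) (τ : N ≃ₐ[F] N) (i : ℕ) :
    τ ∈ ramificationGroup F N P i ↔ τ • π - π ∈ P.asIdeal ^ (i + 1) := by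
  refine ⟨fun h => h π, fun h => ?_⟩
  -- Truncated `π`-adic expansions: `y` is a polynomial in `π` with coefficients from `𝓞 F`, so `τ`
  -- moves it as little as it moves `π`.
  have key : ∀ j : ℕ, ∀ x : 𝓞 N, ∃ y : 𝓞 N,
      τ • y - y ∈ P.asIdeal ^ (i + 1) ∧ x - y ∈ P.asIdeal ^ j := by
    intro j x
    induction j with
    | zero => exact ⟨0, by simp, by simp⟩
    | succ j ih =>
      obtain ⟨y, hy, hxy⟩ := ih
      have hval : val P (π ^ j) = j := by rw [val_pow, hπ, mul_one]
      obtain ⟨d, e, he, hde⟩ := Ideal.exists_mul_add_mem_pow_succ P.ne_bot (π ^ j) (x - y)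
        ((mem_pow_iff_le_val P _ j).2 hval.ge)
        (fun hm => by
          have := (mem_pow_iff_le_val P _ _).1 hm
          rw [hval] at this
          norm_cast at this
          omega) hxy
      obtain ⟨c, hc⟩ := hres d
      refine ⟨y + algebraMap (𝓞 F) (𝓞 N) c * π ^ j, ?_, ?_⟩
      · have h1 : τ • π ^ j - π ^ j ∈ P.asIdeal ^ (i + 1) := by
          rw [smul_pow']
          exact Ideal.mem_of_dvd _ (sub_dvd_pow_sub_pow _ _ j) h
        have h2 : τ • (y + algebraMap (𝓞 F) (𝓞 N) c * π ^ j) -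
            (y + algebraMap (𝓞 F) (𝓞 N) c * π ^ j) =
            (τ • y - y) + algebraMap (𝓞 F) (𝓞 N) c * (τ • π ^ j - π ^ j) := by
          rw [smul_add, smul_mul', smul_algebraMap_ringOfIntegers]
          ring
        rw [h2]
        exact add_mem hy (Ideal.mul_mem_left _ _ h1)
      · have h3 : x - (y + algebraMap (𝓞 F) (𝓞 N) c * π ^ j) =
            π ^ j * (d - algebraMap (𝓞 F) (𝓞 N) c) + e := by
          linear_combination -hde
        rw [h3]
        refine add_mem ?_ he
        rw [pow_succ]
        exact Ideal.mul_mem_mul ((mem_pow_iff_le_val P _ j).2 hval.ge) hc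
  intro x
  -- At precision `i + 1` the error `x - y` lies in `P ^ (i + 1)`, which `τ` preserves.
  obtain ⟨y, hy, hxy⟩ := key (i + 1) x
  have h1 : τ • x - x = τ • (x - y) - (x - y) + (τ • y - y) := by
    rw [smul_sub]
    ring
  rw [h1]
  exact add_mem (sub_mem (smul_mem_pow_of_forall_under_eq huniq τ hxy) hxy) hy

variable [NumberField F]

theorem sum_ramificationIdx_mul_inertiaDeg (p : Ideal (𝓞 F)) [p.IsPrime]
    [Fintype (p.primesOver (𝓞 N))] :
    ∑ Q : p.primesOver (𝓞 N), Q.1.ramificationIdx (𝓞 F) * Q.1.inertiaDeg (𝓞 F) =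
      Module.finrank F N := by
  rw [Ideal.sum_ramification_inertia_eq_finrank]
  exact (IsFractionRing.finrank_eq (𝓞 F) F (𝓞 N) N).symm

theorem ramificationIdx_le_finrank (P : HeightOneSpectrum (𝓞 N)) :
    P.asIdeal.ramificationIdx (𝓞 F) ≤ Module.finrank F N := by
  set p := P.asIdeal.under (𝓞 F)
  have : p.IsMaximal := (P.under (𝓞 F)).isMaximal
  have : Finite (p.primesOver (𝓞 N)) := (Algebra.QuasiFinite.finite_primesOver p).to_subtype
  have := Fintype.ofFinite (p.primesOver (𝓞 N))
  rw [← sum_ramificationIdx_mul_inertiaDeg (N := N) p]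
  exact (Nat.le_mul_of_pos_right _ (Ideal.inertiaDeg_pos ..)).trans
    (Finset.single_le_sum (f := fun Q : p.primesOver (𝓞 N) =>
      Q.1.ramificationIdx (𝓞 F) * Q.1.inertiaDeg (𝓞 F)) (fun Q _ => Nat.zero_le _)
      (Finset.mem_univ (⟨P.asIdeal, P.isPrime, ⟨rfl⟩⟩ : p.primesOver (𝓞 N))))

/-- Total ramification in an extension of prime degree: the prime above is unique and there is no
residue field extension. -/
theorem eq_and_exists_sub_mem_of_dvd_ramificationIdx {q : ℕ} (hq : q ≠ 0)
    (hd : Module.finrank F N = q) (P : HeightOneSpectrum (𝓞 N))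
    (he : q ∣ P.asIdeal.ramificationIdx (𝓞 F)) :
    (∀ Q : HeightOneSpectrum (𝓞 N), Q.under (𝓞 F) = P.under (𝓞 F) → Q = P) ∧
      ∀ x : 𝓞 N, ∃ c : 𝓞 F, x - algebraMap (𝓞 F) (𝓞 N) c ∈ P.asIdeal := by
  classical
  set p := P.asIdeal.under (𝓞 F) with hp
  have : p.IsMaximal := (P.under (𝓞 F)).isMaximal
  have : Finite (p.primesOver (𝓞 N)) := (Algebra.QuasiFinite.finite_primesOver p).to_subtype
  have := Fintype.ofFinite (p.primesOver (𝓞 N))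
  have hsum := sum_ramificationIdx_mul_inertiaDeg (N := N) p
  have hPl : P.asIdeal.LiesOver p := ⟨rfl⟩
  have hPmax : P.asIdeal.IsMaximal := P.isMaximal
  let P' : p.primesOver (𝓞 N) := ⟨P.asIdeal, P.isPrime, hPl⟩
  have hpos : ∀ Q : p.primesOver (𝓞 N),
      0 < Q.1.ramificationIdx (𝓞 F) * Q.1.inertiaDeg (𝓞 F) := fun Q => by
    have := Q.2.1
    exact Nat.mul_pos (Ideal.ramificationIdx_pos ..) (Ideal.inertiaDeg_pos ..)
  have heq : q ≤ P.asIdeal.ramificationIdx (𝓞 F) :=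
    Nat.le_of_dvd (Ideal.ramificationIdx_pos ..) he
  have hf : 0 < P.asIdeal.inertiaDeg (𝓞 F) := Ideal.inertiaDeg_pos ..
  have hle : P.asIdeal.ramificationIdx (𝓞 F) * P.asIdeal.inertiaDeg (𝓞 F) ≤ q :=
    hd ▸ hsum ▸ Finset.single_le_sum (f := fun Q : p.primesOver (𝓞 N) =>
      Q.1.ramificationIdx (𝓞 F) * Q.1.inertiaDeg (𝓞 F)) (fun Q _ => Nat.zero_le _)
      (Finset.mem_univ P')
  constructor
  · intro Q hQ
    by_contra hne
    let Q' : p.primesOver (𝓞 N) :=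
      ⟨Q.asIdeal, Q.isPrime, ⟨(congrArg HeightOneSpectrum.asIdeal hQ).symm⟩⟩
    have hne' : P' ≠ Q' := fun h => hne (HeightOneSpectrum.ext (congrArg Subtype.val h).symm)
    have h2 := Finset.add_le_sum (f := fun Q : p.primesOver (𝓞 N) =>
      Q.1.ramificationIdx (𝓞 F) * Q.1.inertiaDeg (𝓞 F)) (s := Finset.univ)
      (fun Q _ => Nat.zero_le _) (Finset.mem_univ P') (Finset.mem_univ Q') hne'
    rw [hsum, hd] at h2
    have h3 := hpos Q'
    have h4 : q ≤ P'.1.ramificationIdx (𝓞 F) * P'.1.inertiaDeg (𝓞 F) :=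
      heq.trans (Nat.le_mul_of_pos_right _ hf)
    omega
  · have hf1 : P.asIdeal.inertiaDeg (𝓞 F) = 1 := by
      by_contra hne
      have : q * 2 ≤ q := le_trans (Nat.mul_le_mul heq (by omega)) hle
      omega
    rw [Ideal.inertiaDeg_eq_of_isMaximal p P.asIdeal] at hf1
    let := Ideal.Quotient.field p
    intro x
    obtain ⟨c, hc⟩ := (finrank_eq_one_iff_of_nonzero' (1 : 𝓞 N ⧸ P.asIdeal) one_ne_zero).1 hf1
      (Ideal.Quotient.mk _ x)
    obtain ⟨c, rfl⟩ := Ideal.Quotient.mk_surjective c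
    refine ⟨c, ?_⟩
    rw [← Ideal.Quotient.eq, ← hc, Algebra.smul_def, mul_one]
    rfl

/-- In the totally ramified case a single uniformizer decides membership of `τ` in every `G_i`. It
may depend on `τ`, as the uniformizers built below at `3` do. -/
theorem conductorExponent_eq_of_val_eq [FiniteDimensional F N] [Nontrivial (N ≃ₐ[F] N)] {q : ℕ}
    (hq : q ≠ 0) (hd : Module.finrank F N = q) {P : HeightOneSpectrum (𝓞 N)}
    (he : q ∣ P.asIdeal.ramificationIdx (𝓞 F)) {n : ℕ}
    (h : ∀ τ : N ≃ₐ[F] N, τ ≠ 1 → ∃ π : 𝓞 N, val P π = 1 ∧ val P (τ • π - π) = n) :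
    conductorExponent F N P = n := by
  obtain ⟨huniq, hres⟩ := eq_and_exists_sub_mem_of_dvd_ramificationIdx hq hd P he
  refine conductorExponent_eq fun τ hτ i => ?_
  obtain ⟨π, hπ, hn⟩ := h τ hτ
  rw [mem_ramificationGroup_iff huniq hres hπ, mem_pow_iff_le_val, hn, Nat.cast_le,
    Nat.succ_le_iff]

end Ramification

end PureCubic

namespace PureCubic

/-! ### Primes of `ℚ(ω)`: only `3` ramifies, with `z - 1` as uniformizer. -/

section Eisenstein

variable {F : Type*} [Field F]

theorem liesOver_span_of_natCast_mem {P : HeightOneSpectrum (𝓞 F)} {p : ℕ} (hp : p.Prime)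
    (h : (p : 𝓞 F) ∈ P.asIdeal) : P.asIdeal.LiesOver (Ideal.span {(p : ℤ)}) := by
  have := Fact.mk hp
  refine ⟨(Int.ideal_span_isMaximal_of_prime p).eq_of_le (Ideal.comap_ne_top _ P.isPrime.ne_top) ?_⟩
  rw [Ideal.span_singleton_le_iff_mem, Ideal.mem_comap]
  simpa using h

theorem natCast_notMem_of_not_dvd {P : HeightOneSpectrum (𝓞 F)} {p n : ℕ} (hp : p.Prime)
    (h : (p : 𝓞 F) ∈ P.asIdeal) (hn : ¬ p ∣ n) : (n : 𝓞 F) ∉ P.asIdeal := by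
  have := liesOver_span_of_natCast_mem hp h
  intro hm
  apply hn
  have h1 : (n : ℤ) ∈ Ideal.span {(p : ℤ)} := by
    rw [Ideal.over_def P.asIdeal (Ideal.span {(p : ℤ)}), Ideal.mem_comap]
    simpa using hm
  exact_mod_cast Ideal.mem_span_singleton.1 h1

variable [NumberField F]

/-- The absolute norm of `P` is a nonzero integer in `P`; as `P` is prime, it contains a prime
factor of it. -/
theorem exists_prime_natCast_mem (P : HeightOneSpectrum (𝓞 F)) :
    ∃ p : ℕ, p.Prime ∧ (p : 𝓞 F) ∈ P.asIdeal := by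
  have key : ∀ n : ℕ, n ≠ 0 → (n : 𝓞 F) ∈ P.asIdeal →
      ∃ p : ℕ, p.Prime ∧ (p : 𝓞 F) ∈ P.asIdeal := by
    intro n
    induction n using Nat.recOnMul with
    | zero => exact fun h => absurd rfl h
    | one => exact fun _ h => absurd ((Ideal.eq_top_iff_one _).2 (by simpa using h)) P.isPrime.ne_top
    | prime p hp => exact fun _ h => ⟨p, hp, h⟩
    | mul a b iha ihb =>
      intro hab h
      rw [Nat.cast_mul] at h
      rcases P.isPrime.mem_or_mem h with h | h
      · exact iha (left_ne_zero_of_mul hab) h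
      · exact ihb (right_ne_zero_of_mul hab) h
  exact key _ (mt Ideal.absNorm_eq_zero_iff.1 P.ne_bot) (Ideal.absNorm_mem P.asIdeal)

theorem val_natCast_of_not_dvd {P : HeightOneSpectrum (𝓞 F)} {p n : ℕ} (hp : p.Prime)
    (h : (p : 𝓞 F) ∈ P.asIdeal) (hn : ¬ p ∣ n) : val P (n : 𝓞 F) = 0 :=
  (val_eq_zero_iff P _).2 (natCast_notMem_of_not_dvd hp h hn)

theorem val_eq_zero_of_isUnit (P : HeightOneSpectrum (𝓞 F)) {x : 𝓞 F} (hx : IsUnit x) :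
    val P x = 0 :=
  (val_eq_zero_iff P _).2 fun h => P.isPrime.ne_top (Ideal.eq_top_of_isUnit_mem _ h hx)

theorem isUnit_of_sq_add_add_one_eq_zero {R : Type*} [CommRing R] {z : R} (hz : z ^ 2 + z + 1 = 0) :
    IsUnit z :=
  IsUnit.of_mul_eq_one (-z - 1) (by linear_combination -hz)

variable [IsCyclotomicExtension {3} ℚ F]

theorem val_natCast_prime {P : HeightOneSpectrum (𝓞 F)} {p : ℕ} (hp : p.Prime) (hp3 : p ≠ 3)
    (h : (p : 𝓞 F) ∈ P.asIdeal) : val P (p : 𝓞 F) = 1 := by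
  have := Fact.mk hp
  have hl := liesOver_span_of_natCast_mem hp h
  have hp0 : Prime (Ideal.span {(p : ℤ)}) :=
    (Ideal.prime_span_singleton_iff).2 (Nat.prime_iff_prime_int.1 hp)
  have he := IsCyclotomicExtension.Rat.ramificationIdx_eq_of_not_dvd (m := 3) p F P.asIdeal
    (fun hd => hp3 ((Nat.prime_dvd_prime_iff_eq hp Nat.prime_three).1 hd))
  have h1 := Ideal.IsDedekindDomain.emultiplicity_map_eq_ramificationIdx'_mul (S := 𝓞 F) hp0.ne_zero
    hp0.irreducible P.irreducible P.ne_bot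
  rw [Ideal.ramificationIdx'_eq_ramificationIdx _ _ hp0.ne_zero, he,
    (FiniteMultiplicity.of_prime_left hp0 hp0.ne_zero).emultiplicity_self, Ideal.map_span] at h1
  simpa [val] using h1

theorem val_sub_one_of_three_mem {P : HeightOneSpectrum (𝓞 F)} (h : (3 : 𝓞 F) ∈ P.asIdeal)
    {z : 𝓞 F} (hz : z ^ 2 + z + 1 = 0) : val P (z - 1) = 1 := by
  have := Fact.mk Nat.prime_three
  have hl := liesOver_span_of_natCast_mem (P := P) Nat.prime_three (by exact_mod_cast h)
  have hζ : IsPrimitiveRoot (z : F) 3 := by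
    have hz' : (z : F) ^ 2 + z + 1 = 0 := by exact_mod_cast congrArg (algebraMap (𝓞 F) F) hz
    rw [← Polynomial.isRoot_cyclotomic_iff]
    simp [Polynomial.cyclotomic_three, hz']
  have hP := IsCyclotomicExtension.Rat.eq_span_zeta_sub_one_of_liesOver' 3 F hζ P.asIdeal
  rw [val, show z = hζ.toInteger from rfl, ← hP]
  exact (FiniteMultiplicity.of_prime_left P.prime P.ne_bot).emultiplicity_self

theorem exists_sq_add_add_one_eq_zero : ∃ z : 𝓞 F, z ^ 2 + z + 1 = 0 := by
  have hζ := IsCyclotomicExtension.zeta_spec 3 ℚ F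
  refine ⟨hζ.toInteger, ?_⟩
  ext
  have h := Polynomial.isRoot_cyclotomic_iff.2 hζ
  rw [Polynomial.cyclotomic_three, Polynomial.IsRoot, Polynomial.eval_add, Polynomial.eval_add] at h
  simp only [Polynomial.eval_pow, Polynomial.eval_X, Polynomial.eval_one] at h
  exact h

theorem val_three {P : HeightOneSpectrum (𝓞 F)} (h : (3 : 𝓞 F) ∈ P.asIdeal) :
    val P (3 : 𝓞 F) = 2 := by
  obtain ⟨z, hz⟩ := exists_sq_add_add_one_eq_zero (F := F)
  have h1 : (z - 1) ^ 2 = -(z * 3) := by linear_combination hz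
  have h2 := congrArg (val P) h1
  rw [val_pow, val_sub_one_of_three_mem h hz, val_neg, val_mul,
    val_eq_zero_of_isUnit P (isUnit_of_sq_add_add_one_eq_zero hz)] at h2
  simpa using h2.symm

end Eisenstein

end PureCubic

namespace PureCubic

/-! ### Local conductors of cubic Kummer extensions. -/

section Kummer

/-- Every nontrivial automorphism multiplies `α` by a primitive cube root of unity. -/
def IsKummerGenerator (F : Type*) {N : Type*} [Field F] [Field N] [Algebra F N] (α : 𝓞 N) : Prop :=
  ∀ τ : N ≃ₐ[F] N, τ ≠ 1 →
    ∃ z : 𝓞 F, z ^ 2 + z + 1 = 0 ∧ τ • α = algebraMap (𝓞 F) (𝓞 N) z * α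

variable {F N : Type*} [Field F] [Field N] [Algebra F N]

theorem algebraMap_sq_add_add_one {z : 𝓞 F} (hz : z ^ 2 + z + 1 = 0) :
    algebraMap (𝓞 F) (𝓞 N) z ^ 2 + algebraMap (𝓞 F) (𝓞 N) z + 1 = 0 := by
  simpa using congrArg (algebraMap (𝓞 F) (𝓞 N)) hz

theorem conductorExponent_eq_zero_of_not_dvd [FiniteDimensional F N]
    [Nontrivial (N ≃ₐ[F] N)] {α : 𝓞 N} (hα : IsKummerGenerator F α)
    {P : HeightOneSpectrum (𝓞 N)} (h3 : (3 : 𝓞 N) ∉ P.asIdeal) (hP : α ∉ P.asIdeal) :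
    conductorExponent F N P = 0 := by
  refine conductorExponent_eq_zero fun τ hτ => ⟨α, fun h => ?_⟩
  obtain ⟨z, hz, hτα⟩ := hα τ hτ
  have hz' := algebraMap_sq_add_add_one (N := N) hz
  set w := algebraMap (𝓞 F) (𝓞 N) z
  rw [hτα, show w * α - α = (w - 1) * α by ring] at h
  refine h3 ?_
  rw [show (3 : 𝓞 N) = (w - 1) * (-2 - w) by linear_combination hz']
  exact Ideal.mul_mem_right _ _ ((P.isPrime.mem_or_mem h).resolve_right hP)

theorem smul_three (τ : N ≃ₐ[F] N) : τ • (3 : 𝓞 N) = 3 := by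
  have := smul_algebraMap_ringOfIntegers τ (3 : 𝓞 F)
  rwa [map_ofNat (algebraMap (𝓞 F) (𝓞 N)) 3] at this

/-- The quotient `x / c` has the integral `n`-th power `y`, and `𝓞 N` is integrally closed. -/
theorem exists_mul_eq_of_pow_eq {c x y : 𝓞 N} (hc : c ≠ 0) {n : ℕ} (hn : 0 < n)
    (h : x ^ n = c ^ n * y) : ∃ π : 𝓞 N, c * π = x := by
  have hc' : (c : N) ≠ 0 := mt (fun h0 => RingOfIntegers.ext h0) hc
  have hi : IsIntegral ℤ ((x : N) / c) := by
    refine IsIntegral.of_pow hn ?_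
    have h' : (x : N) ^ n = (c : N) ^ n * (y : N) := congrArg (algebraMap (𝓞 N) N) h
    rw [div_pow, h', mul_div_cancel_left₀ _ (pow_ne_zero n hc')]
    exact y.isIntegral_coe
  refine ⟨⟨_, hi⟩, RingOfIntegers.ext ?_⟩
  exact mul_div_cancel₀ _ hc'

theorem intCast_notMem_of_not_dvd {P : HeightOneSpectrum (𝓞 N)} {p : ℕ} {n : ℤ} (hp : p.Prime)
    (h : (p : 𝓞 N) ∈ P.asIdeal) (hn : ¬ (p : ℤ) ∣ n) : (n : 𝓞 N) ∉ P.asIdeal := by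
  have := natCast_notMem_of_not_dvd (n := n.natAbs) hp h (by rwa [← Int.natCast_dvd])
  rcases Int.natAbs_eq n with hn' | hn' <;> rw [hn'] <;> simpa using this

open Polynomial in
-- Write `x = 1 + bλ` with `λ = w - 1`, expand `x³ = 1 + 9u` and divide by `λ³`. Since `3 = -w²λ²`,
-- all coefficients of the resulting monic cubic in `b` are integral.
theorem isIntegral_sub_one_div_sub_one {R K : Type*} [CommRing R] [Field K] [Algebra R K] {x : K}
    (w : R) (u : ℤ) (hw1 : algebraMap R K w - 1 ≠ 0)
    (hw : algebraMap R K w ^ 2 + algebraMap R K w + 1 = 0) (hx : x ^ 3 = 1 + 9 * u) :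
    IsIntegral R ((x - 1) / (algebraMap R K w - 1)) := by
  obtain ⟨b, hb⟩ : ∃ b, b = (x - 1) / (algebraMap R K w - 1) := ⟨_, rfl⟩
  have hxb : x = 1 + b * (algebraMap R K w - 1) := by rw [hb, div_mul_cancel₀ _ hw1]; ring
  rw [← hb]
  rw [hxb] at hx
  let p : R[X] := X ^ 3 - (C (w ^ 2 * (w - 1)) * X ^ 2 + C (w ^ 2) * X + C (w * (w - 1) * u))
  have hp : p.Monic := monic_X_pow_sub (n := 3)
    (p := C (w ^ 2 * (w - 1)) * X ^ 2 + C (w ^ 2) * X + C (w * (w - 1) * u)) 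
    degree_quadratic_lt
  refine ⟨p, hp, ?_⟩
  simp only [p, eval₂_sub, eval₂_add, eval₂_mul, eval₂_X_pow, eval₂_C, eval₂_X]
  simp only [map_mul, map_pow, map_sub, map_one, map_intCast]
  generalize algebraMap R K w = v at *
  refine mul_left_cancel₀ (pow_ne_zero 3 hw1) ?_
  linear_combination hx + ((v - 1) ^ 2 * b ^ 2 + (v - 1) * b) * (-v ^ 2 + 3 * v - 3) * hw +
    u * (-v * (v ^ 2 + v + 1) + 6 * v ^ 2 - 9 * v + 9) * hw

/-- The prime above `3` when the radicand is `1` modulo `9`. -/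
theorem conductorExponent_eq_zero_of_modEq [CharZero N] [FiniteDimensional F N]
    [Nontrivial (N ≃ₐ[F] N)] {θ : 𝓞 N} (hθ : IsKummerGenerator F θ) {u : ℤ}
    (h : θ ^ 3 = 1 + 9 * u) {P : HeightOneSpectrum (𝓞 N)} (hP : (3 : 𝓞 N) ∈ P.asIdeal) :
    conductorExponent F N P = 0 := by
  have hθP : θ ∉ P.asIdeal := by
    refine fun hm => P.isPrime.ne_top ((Ideal.eq_top_iff_one _).2 ?_)
    have h1 : (1 : 𝓞 N) = θ ^ 2 * θ - 3 * (u * 3) := by linear_combination -h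
    rw [h1]
    exact sub_mem (Ideal.mul_mem_left _ _ hm) (Ideal.mul_mem_right _ _ hP)
  refine conductorExponent_eq_zero fun τ hτ => ?_
  obtain ⟨z, hz, hτθ⟩ := hθ τ hτ
  have hz' := algebraMap_sq_add_add_one (N := N) hz
  set w := algebraMap (𝓞 F) (𝓞 N) z with hwdef
  have hw1 : w - 1 ≠ 0 := by
    intro h0
    rw [sub_eq_zero.1 h0] at hz'
    norm_num at hz'
  have hwN : ((w : N) - 1) ≠ 0 := by exact_mod_cast mt (RingOfIntegers.ext_iff.2 ·) hw1
  obtain ⟨β, hβ⟩ : ∃ β : 𝓞 N, (w - 1) * β = θ - 1 := by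
    have hwN2 : (w : N) ^ 2 + w + 1 = 0 := congrArg (algebraMap (𝓞 N) N) hz'
    have hN : (θ : N) ^ 3 = 1 + 9 * u := congrArg (algebraMap (𝓞 N) N) h
    have hi := isIntegral_sub_one_div_sub_one w u hwN hwN2 hN
    refine ⟨⟨_, isIntegral_trans (R := ℤ) _ hi⟩, ?_⟩
    ext
    change ((w : N) - 1) * (((θ : N) - 1) / ((w : N) - 1)) = (θ : N) - 1
    exact mul_div_cancel₀ _ hwN
  refine ⟨β, ?_⟩
  have h4 := congrArg (τ • ·) hβ
  simp only [smul_mul', smul_sub, smul_one, hτθ] at h4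
  rw [hwdef, smul_algebraMap_ringOfIntegers, ← hwdef] at h4
  -- Here `β = (θ - 1) / (w - 1)` and `τθ = wθ`, so `τβ - β = θ`, a unit at `P`: the extension is
  -- unramified there.
  rwa [show τ • β - β = θ from mul_left_cancel₀ hw1 (by linear_combination h4 - hβ)]

variable [NumberField N]

/-- The valuations give `3 + 2·2 - 6 = 1`. With `l = w - 1` this produces a uniformizer above `3` in
both ramified cases. -/
theorem val_eq_one_of_three_mul_eq {P : HeightOneSpectrum (𝓞 N)} (h3 : val P 3 = 2 * (3 : ℕ))
    {l α π : 𝓞 N} (hl : val P l = 3) (hα : val P α = (2 : ℕ)) (hπ : 3 * π = l * α ^ 2) :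
    val P π = 1 := by
  have hπv := congrArg (val P) hπ
  rw [val_mul, val_mul, val_pow, hl, hα, h3] at hπv
  have hπ0 : π ≠ 0 := by
    rintro rfl
    rw [val, Ideal.span_singleton_zero, ← Ideal.zero_eq_bot, emultiplicity_zero] at hπv
    norm_cast at hπv
  obtain ⟨j, hj⟩ := exists_val_eq P hπ0
  rw [hj] at hπv ⊢
  norm_cast at hπv ⊢
  omega

variable [NumberField F]

theorem ramificationIdx_eq_three (hd : Module.finrank F N = 3) {P : HeightOneSpectrum (𝓞 N)}
    (h : 3 ∣ P.asIdeal.ramificationIdx (𝓞 F)) : P.asIdeal.ramificationIdx (𝓞 F) = 3 := by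
  have h1 := ramificationIdx_le_finrank (F := F) P
  have h2 := Ideal.ramificationIdx_pos P.asIdeal (𝓞 F)
  omega

variable [IsCyclotomicExtension {3} ℚ F]

theorem val_natCast_eq_ramificationIdx (P : HeightOneSpectrum (𝓞 N)) {p : ℕ} (hp : p.Prime)
    (hp3 : p ≠ 3) (h : (p : 𝓞 N) ∈ P.asIdeal) :
    val P (p : 𝓞 N) = P.asIdeal.ramificationIdx (𝓞 F) := by
  have h' : (p : 𝓞 F) ∈ (P.under (𝓞 F)).asIdeal := by
    change algebraMap (𝓞 F) (𝓞 N) p ∈ P.asIdeal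
    simpa using h
  have := val_algebraMap P (x := (p : 𝓞 F)) (by exact_mod_cast hp.ne_zero)
  rw [val_natCast_prime hp hp3 h', mul_one] at this
  simpa using this

theorem val_three_eq_two_mul_ramificationIdx (P : HeightOneSpectrum (𝓞 N))
    (h : (3 : 𝓞 N) ∈ P.asIdeal) :
    val P (3 : 𝓞 N) = 2 * P.asIdeal.ramificationIdx (𝓞 F) := by
  have h' : (3 : 𝓞 F) ∈ (P.under (𝓞 F)).asIdeal := by
    change algebraMap (𝓞 F) (𝓞 N) 3 ∈ P.asIdeal
    rwa [map_ofNat (algebraMap (𝓞 F) (𝓞 N)) 3]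
  have := val_algebraMap P (x := (3 : 𝓞 F)) (by norm_num)
  rwa [val_three h', mul_comm, map_ofNat (algebraMap (𝓞 F) (𝓞 N)) 3] at this

theorem val_sub_one_eq_ramificationIdx (P : HeightOneSpectrum (𝓞 N))
    (h : (3 : 𝓞 N) ∈ P.asIdeal) {z : 𝓞 F} (hz : z ^ 2 + z + 1 = 0) :
    val P (algebraMap (𝓞 F) (𝓞 N) z - 1) = P.asIdeal.ramificationIdx (𝓞 F) := by
  have h' : (3 : 𝓞 F) ∈ (P.under (𝓞 F)).asIdeal := by
    change algebraMap (𝓞 F) (𝓞 N) 3 ∈ P.asIdeal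
    rwa [map_ofNat (algebraMap (𝓞 F) (𝓞 N)) 3]
  have h1 := val_sub_one_of_three_mem h' hz
  have := val_algebraMap P (x := z - 1) (fun h0 => by
    rw [h0] at h1
    simp [val] at h1)
  rw [h1, mul_one] at this
  simpa using this

variable [FiniteDimensional F N] [Nontrivial (N ≃ₐ[F] N)]

/-- Tame ramification. -/
theorem conductorExponent_eq_one (hd : Module.finrank F N = 3) {α : 𝓞 N}
    (hα : IsKummerGenerator F α) {p m : ℕ} (hp : p.Prime) (hp3 : p ≠ 3) (hm : ¬ p ∣ m)
    (h : α ^ 3 = p * m) {P : HeightOneSpectrum (𝓞 N)} (hP : (p : 𝓞 N) ∈ P.asIdeal) :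
    conductorExponent F N P = 1 := by
  have h3 : (3 : 𝓞 N) ∉ P.asIdeal := by
    exact_mod_cast natCast_notMem_of_not_dvd (n := 3) hp hP
      fun hd => hp3 ((Nat.prime_dvd_prime_iff_eq hp Nat.prime_three).1 hd)
  have hα0 : α ≠ 0 := by
    rintro rfl
    have : (p : 𝓞 N) * m ≠ 0 := by
      have : m ≠ 0 := by rintro rfl; simp at hm
      exact_mod_cast mul_ne_zero hp.ne_zero this
    exact this (by rw [← h]; simp)
  obtain ⟨k, hk⟩ := exists_val_eq P hα0
  have hv := congrArg (val P) h
  rw [val_pow, val_mul, val_natCast_eq_ramificationIdx (F := F) P hp hp3 hP,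
    val_natCast_of_not_dvd hp hP hm, hk, add_zero] at hv
  -- As `p` is unramified in `F`, this forces total ramification and makes `α` a uniformizer.
  have hv' : 3 * k = P.asIdeal.ramificationIdx (𝓞 F) := by exact_mod_cast hv
  have he := ramificationIdx_eq_three hd ⟨k, hv'.symm⟩
  obtain rfl : k = 1 := by omega
  refine conductorExponent_eq_of_val_eq three_ne_zero hd ⟨1, hv'.symm⟩ fun τ hτ => ⟨α, by simpa using hk, ?_⟩
  obtain ⟨z, hz, hτα⟩ := hα τ hτ
  have hz' := algebraMap_sq_add_add_one (N := N) hz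
  rw [hτα]
  set w := algebraMap (𝓞 F) (𝓞 N) z
  have hw : val P (w - 1) = 0 := by
    refine (val_eq_zero_iff P _).2 fun hw => h3 ?_
    rw [show (3 : 𝓞 N) = (w - 1) * (-2 - w) by linear_combination hz']
    exact Ideal.mul_mem_right _ _ hw
  rw [show w * α - α = (w - 1) * α by ring, val_mul, hw, hk, zero_add]

/-- The prime above `3` when the radicand has valuation `1` at `3`. -/
theorem conductorExponent_eq_four (hd : Module.finrank F N = 3) {α : 𝓞 N}
    (hα : IsKummerGenerator F α) {m : ℕ} (hm : ¬ 3 ∣ m)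
    (h : α ^ 3 = 3 * m) {P : HeightOneSpectrum (𝓞 N)} (hP : (3 : 𝓞 N) ∈ P.asIdeal) :
    conductorExponent F N P = 4 := by
  have hP' : ((3 : ℕ) : 𝓞 N) ∈ P.asIdeal := by exact_mod_cast hP
  have hm0 : (m : 𝓞 N) ≠ 0 := by
    have : m ≠ 0 := by rintro rfl; simp at hm
    exact_mod_cast this
  have hα0 : α ≠ 0 := by
    rintro rfl
    exact hm0 (by simpa using h)
  obtain ⟨k, hk⟩ := exists_val_eq P hα0
  have h3 := val_three_eq_two_mul_ramificationIdx (F := F) P hP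
  have hv := congrArg (val P) h
  rw [val_pow, val_mul, h3, val_natCast_of_not_dvd Nat.prime_three hP' hm, hk, add_zero] at hv
  -- Hence `e = 3` and `α` has valuation `2`; the uniformizer will be `(w - 1) α² / 3`, which is
  -- integral because its cube is.
  have hv' : 3 * k = 2 * P.asIdeal.ramificationIdx (𝓞 F) := by exact_mod_cast hv
  have he := ramificationIdx_eq_three hd (P := P) (by omega)
  have hk2 : k = 2 := by omega
  rw [he] at h3
  refine conductorExponent_eq_of_val_eq three_ne_zero hd (he ▸ dvd_rfl) fun τ hτ => ?_
  obtain ⟨z, hz, hτα⟩ := hα τ hτ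
  have hz' := algebraMap_sq_add_add_one (N := N) hz
  have hw := val_sub_one_eq_ramificationIdx P hP hz
  set w := algebraMap (𝓞 F) (𝓞 N) z with hwdef
  have hw0 := val_eq_zero_of_isUnit P (isUnit_of_sq_add_add_one_eq_zero hz')
  obtain ⟨π, hπ⟩ := exists_mul_eq_of_pow_eq (c := 3) (n := 3) (x := (w - 1) * α ^ 2) (y := -w * (w - 1) * (m : 𝓞 N) ^ 2) (by norm_num) (by norm_num) (by
    have e1 : (w - 1) ^ 2 = -3 * w := by linear_combination hz'
    calc ((w - 1) * α ^ 2) ^ 3 = (w - 1) ^ 2 * (w - 1) * (α ^ 3) ^ 2 := by ring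
      _ = _ := by
        rw [e1, h]
        ring)
  have hj := val_eq_one_of_three_mul_eq h3 (by rw [hw, he]; rfl) (by rw [hk, hk2]) hπ
  refine ⟨π, hj, ?_⟩
  have hτπ : τ • π = w ^ 2 * π := by
    have h30 : (3 : 𝓞 N) ≠ 0 := by norm_num
    refine mul_left_cancel₀ h30 ?_
    have := congrArg (τ • ·) hπ
    simp only [smul_mul', smul_pow', smul_sub, smul_one, hτα] at this
    rw [hwdef, smul_algebraMap_ringOfIntegers, ← hwdef] at this
    rw [smul_three] at this
    linear_combination this - w ^ 2 * hπ
  -- The difference is `(w² - 1)π`, and `w + 1 = -w²` is a unit: the valuation is `3 + 1`.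
  rw [show τ • π - π = -(w ^ 2 * ((w - 1) * π)) by linear_combination hτπ + (w-1)*π*hz',
    val_neg, val_mul, val_pow, val_mul, hw0, hw, he, hj]
  norm_num

/-- The prime above `3` when the radicand is `1` modulo `3` but not modulo `9`. -/
theorem conductorExponent_eq_two (hd : Module.finrank F N = 3) {θ : 𝓞 N}
    (hθ : IsKummerGenerator F θ) {u : ℤ} (hu : ¬ 3 ∣ u)
    (h : θ ^ 3 = 1 + 3 * u) {P : HeightOneSpectrum (𝓞 N)} (hP : (3 : 𝓞 N) ∈ P.asIdeal) :
    conductorExponent F N P = 2 := by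
  have hP' : ((3 : ℕ) : 𝓞 N) ∈ P.asIdeal := by exact_mod_cast hP
  have hu' := intCast_notMem_of_not_dvd Nat.prime_three hP' hu
  have h2 : val P (2 : 𝓞 N) = 0 := by
    exact_mod_cast val_natCast_of_not_dvd (n := 2) Nat.prime_three hP' (by norm_num)
  set α := θ - 1 with hα
  -- The shift `α = θ - 1` lies in `P`; since `3 ∤ u`, the cofactor of `3` is a unit at `P`, so `α`
  -- again has valuation `2` and `e = 3`.
  have hα3 : α ^ 3 = 3 * (u - α - α ^ 2) := by
    rw [hα]
    linear_combination h
  have hαP : α ∈ P.asIdeal :=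
    P.isPrime.mem_of_pow_mem 3 (hα3 ▸ Ideal.mul_mem_right _ _ hP)
  have hβ : val P ((u : 𝓞 N) - α - α ^ 2) = 0 := by
    refine (val_eq_zero_iff P _).2 fun hm => hu' ?_
    have := add_mem hm (Ideal.mul_mem_right (1 + α) _ hαP)
    ring_nf at this
    exact this
  have hθ0 : val P θ = 0 := by
    refine (val_eq_zero_iff P _).2 fun hm => P.isPrime.ne_top ((Ideal.eq_top_iff_one _).2 ?_)
    have := sub_mem hm hαP
    rwa [hα, sub_sub_cancel] at this
  set β := (u : 𝓞 N) - α - α ^ 2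
  have hβ0 : β ≠ 0 := by
    intro h0
    simp [h0, val] at hβ
  have hα0 : α ≠ 0 := by
    intro h0
    rw [h0] at hα3
    exact hβ0 (by simpa using hα3)
  obtain ⟨k, hk⟩ := exists_val_eq P hα0
  have h3 := val_three_eq_two_mul_ramificationIdx (F := F) P hP
  have hv := congrArg (val P) hα3
  rw [val_pow, val_mul, h3, hβ, hk, add_zero] at hv
  have hv' : 3 * k = 2 * P.asIdeal.ramificationIdx (𝓞 F) := by exact_mod_cast hv
  have he := ramificationIdx_eq_three hd (P := P) (by omega)
  obtain rfl : k = 2 := by omega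
  rw [he] at h3
  refine conductorExponent_eq_of_val_eq three_ne_zero hd (he ▸ dvd_rfl) fun τ hτ => ?_
  obtain ⟨z, hz, hτθ⟩ := hθ τ hτ
  have hz' := algebraMap_sq_add_add_one (N := N) hz
  have hw := val_sub_one_eq_ramificationIdx P hP hz
  set w := algebraMap (𝓞 F) (𝓞 N) z with hwdef
  have hw0 := val_eq_zero_of_isUnit P (isUnit_of_sq_add_add_one_eq_zero hz')
  have e1 : (w - 1) ^ 2 = -3 * w := by linear_combination hz'
  obtain ⟨π, hπ⟩ := exists_mul_eq_of_pow_eq (c := 3) (n := 3) (x := (w - 1) * α ^ 2) (y := -w * (w - 1) * β ^ 2) (by norm_num) (by norm_num) (by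
    calc ((w - 1) * α ^ 2) ^ 3 = (w - 1) ^ 2 * (w - 1) * (α ^ 3) ^ 2 := by ring
      _ = _ := by
        rw [e1, hα3]
        ring)
  refine ⟨π, val_eq_one_of_three_mul_eq h3 (by rw [hw, he]; rfl) hk hπ, ?_⟩
  have h30 : (3 : 𝓞 N) ≠ 0 := by norm_num
  have hτπ : τ • π - π = -(w * (θ * (2 * α + (w - 1) * θ))) := by
    refine mul_left_cancel₀ h30 ?_
    have h4 := congrArg (τ • ·) hπ
    have hτα : τ • α = α + (w - 1) * θ := by
      rw [hα, smul_sub, hτθ, smul_one]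
      ring
    simp only [smul_mul', smul_pow', smul_sub, smul_one, hτα] at h4
    rw [hwdef, smul_algebraMap_ringOfIntegers, ← hwdef, smul_three] at h4
    linear_combination h4 - hπ + (θ * (2 * α + (w - 1) * θ)) * e1
  -- The valuations are `2` and `3`. Unlike before, `τ` does not scale `α` but adds `(w - 1)θ` to
  -- it, whence the smaller exponent `2`.
  have hlt : val P (2 * α) < val P ((w - 1) * θ) := by
    rw [val_mul, val_mul, h2, hk, hw, he, hθ0]
    norm_num
  rw [hτπ, val_neg, val_mul, val_mul, val_add_eq_of_lt P hlt, hw0, hθ0, val_mul, h2, hk]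
  norm_num

end Kummer

end PureCubic

namespace PureCubic

/-! ### The global conductor in terms of `(a, b)`. -/

section Conductor

variable {F N : Type*} [Field F] [Field N] [Algebra F N]

/-- The image `τα` has the same cube as `α`, so it is `α`, `zα` or `z²α`; the first would force `τ =
1`. -/
theorem isKummerGenerator_of_pow_three_eq {α : 𝓞 N} {n : ℤ} (h : α ^ 3 = n)
    (hz : ∃ z : 𝓞 F, z ^ 2 + z + 1 = 0) (hfix : ∀ τ : N ≃ₐ[F] N, τ • α = α → τ = 1) :
    IsKummerGenerator F α := by
  intro τ hτ
  obtain ⟨z, hz⟩ := hz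
  have hw := algebraMap_sq_add_add_one (N := N) hz
  have h1 : (τ • α) ^ 3 = α ^ 3 := by
    rw [← smul_pow', h]
    simpa using smul_algebraMap_ringOfIntegers τ (n : 𝓞 F)
  have h2 : (τ • α - α) * ((τ • α - algebraMap (𝓞 F) (𝓞 N) z * α) *
      (τ • α - algebraMap (𝓞 F) (𝓞 N) (z ^ 2) * α)) = 0 := by
    rw [map_pow]
    generalize algebraMap (𝓞 F) (𝓞 N) z = w at *
    linear_combination h1 + (-(τ • α) ^ 2 * α + w * (τ • α) * α ^ 2 - (w - 1) * α ^ 3) * hw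
  rcases mul_eq_zero.1 h2 with h3 | h3
  · exact absurd (hfix τ (sub_eq_zero.1 h3)) hτ
  · rcases mul_eq_zero.1 h3 with h3 | h3
    · exact ⟨z, hz, sub_eq_zero.1 h3⟩
    · exact ⟨z ^ 2, by linear_combination (z ^ 2 - z + 1) * hz, sub_eq_zero.1 h3⟩

theorem IsKummerGenerator.neg {α : 𝓞 N} (hα : IsKummerGenerator F α) :
    IsKummerGenerator F (-α) := by
  intro τ hτ
  obtain ⟨z, hz, h⟩ := hα τ hτ
  exact ⟨z, hz, by rw [smul_neg, h, mul_neg]⟩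

/-- Squaring replaces `z` by `z²`, and `c` is fixed. With `c = b` this exchanges the roles of `a`
and `b`. -/
theorem IsKummerGenerator.of_mul_eq_sq {α β : 𝓞 N} (hα : IsKummerGenerator F α) {c : 𝓞 F}
    (hc : algebraMap (𝓞 F) (𝓞 N) c ≠ 0) (h : algebraMap (𝓞 F) (𝓞 N) c * β = α ^ 2) :
    IsKummerGenerator F β := by
  intro τ hτ
  obtain ⟨z, hz, hτα⟩ := hα τ hτ
  refine ⟨z ^ 2, by linear_combination (z ^ 2 - z + 1) * hz, mul_left_cancel₀ hc ?_⟩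
  have h1 := congrArg (τ • ·) h
  simp only [smul_mul', smul_pow', hτα, smul_algebraMap_ringOfIntegers] at h1
  rw [map_pow]
  linear_combination h1 - algebraMap (𝓞 F) (𝓞 N) z ^ 2 * h

/-- The integer `f` with `f ℤ[ω]` the conductor of `ℚ(ω, ∛(ab²)) / ℚ(ω)`, for `ab` squarefree. -/
def radicandConductor (a b : ℕ) : ℕ :=
  if a * b ^ 2 % 9 = 1 ∨ a * b ^ 2 % 9 = 8 then a * b else 3 * (a * b)

theorem radicandConductor_ne_zero {a b : ℕ} (h : a * b ≠ 0) : radicandConductor a b ≠ 0 := by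
  rw [radicandConductor]
  split_ifs <;> simp [h]

theorem factorization_eq_one_of_squarefree {n p : ℕ} (hn : Squarefree n) (hp : p.Prime)
    (h : p ∣ n) : n.factorization p = 1 :=
  le_antisymm (hn.natFactorization_le_one p)
    (Nat.one_le_iff_ne_zero.2 (hp.factorization_pos_of_dvd hn.ne_zero h).ne')

theorem factorization_radicandConductor {a b p : ℕ} (hab : Squarefree (a * b)) (hp : p.Prime)
    (hp3 : p ≠ 3) : (radicandConductor a b).factorization p = if p ∣ a * b then 1 else 0 := by
  have h0 := hab.ne_zero
  have h1 : (a * b).factorization p = if p ∣ a * b then 1 else 0 := by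
    split_ifs with h
    · exact factorization_eq_one_of_squarefree hab hp h
    · exact Nat.factorization_eq_zero_of_not_dvd h
  rw [← h1, radicandConductor]
  split_ifs with h
  · rfl
  · rw [Nat.factorization_mul (by norm_num) h0]
    simp [Nat.prime_three.factorization, hp3.symm]

variable [NumberField F]

theorem val_natCast {P : HeightOneSpectrum (𝓞 F)} {p n : ℕ} (hp : p.Prime)
    (h : (p : 𝓞 F) ∈ P.asIdeal) (hn : n ≠ 0) :
    val P (n : 𝓞 F) = n.factorization p * val P (p : 𝓞 F) := by
  conv_lhs => rw [← Nat.ordProj_mul_ordCompl_eq_self n p]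
  rw [Nat.cast_mul, val_mul, val_natCast_of_not_dvd hp h (Nat.not_dvd_ordCompl hp hn), add_zero,
    Nat.cast_pow, val_pow]

variable [IsCyclotomicExtension {3} ℚ F] [NumberField N]

/-- Every rational prime `p` lies under a prime of `N`. Below it in `F`, the valuation of `f` is
`v_p(f)` times `1` or `2`, so the conductor determines the factorization of `f`. -/
theorem isConductor_unique {f g : ℕ} (hf : f ≠ 0) (hg : g ≠ 0)
    (h1 : IsConductor F N (Ideal.span {(f : 𝓞 F)})) (h2 : IsConductor F N (Ideal.span {(g : 𝓞 F)})) :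
    f = g := by
  refine Nat.eq_of_factorization_eq hf hg fun p => ?_
  by_cases hp : p.Prime
  swap
  · simp [hp]
  obtain ⟨M, hM, hpM⟩ := Ideal.exists_le_maximal (Ideal.span {(p : 𝓞 N)}) (by
    rw [Ne, Ideal.span_singleton_eq_top]
    intro hu
    have hu' := hu.map (Algebra.norm ℤ)
    rw [← map_natCast (algebraMap ℤ (𝓞 N)) p, Algebra.norm_algebraMap,
      isUnit_pow_iff (Module.finrank_pos (R := ℤ) (M := 𝓞 N)).ne'] at hu'
    exact (Nat.prime_iff_prime_int.1 hp).not_isUnit hu')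
  rw [Ideal.span_singleton_le_iff_mem] at hpM
  let P : HeightOneSpectrum (𝓞 N) := ⟨M, hM.isPrime, by
    rintro rfl
    exact hp.ne_zero (by exact_mod_cast (Ideal.mem_bot.1 hpM))⟩
  have h := (h1 P).trans (h2 P).symm
  have hp' : (p : 𝓞 F) ∈ (P.under (𝓞 F)).asIdeal := by
    change algebraMap (𝓞 F) (𝓞 N) p ∈ M
    simpa using hpM
  change val (P.under (𝓞 F)) f = val (P.under (𝓞 F)) g at h
  rw [val_natCast hp hp' hf, val_natCast hp hp' hg] at h
  rcases eq_or_ne p 3 with rfl | hp3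
  · have h3 := val_three (P := P.under (𝓞 F)) (by exact_mod_cast hp')
    rw [Nat.cast_ofNat, h3] at h
    norm_cast at h
    omega
  · rw [val_natCast_prime hp hp3 hp'] at h
    simpa using h

variable [FiniteDimensional F N] [Nontrivial (N ≃ₐ[F] N)]

/-- As `ab` is squarefree, a prime dividing `a` divides `ab²` exactly once, so the local
computations apply. -/
theorem conductorExponent_eq_val_of_dvd_left (hd : Module.finrank F N = 3) {a b : ℕ}
    (hab : Squarefree (a * b)) {α : 𝓞 N} (hα : IsKummerGenerator F α) (h : α ^ 3 = a * b ^ 2)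
    {P : HeightOneSpectrum (𝓞 N)} {p : ℕ} (hp : p.Prime) (hP : (p : 𝓞 N) ∈ P.asIdeal) (hpa : p ∣ a) :
    conductorExponent F N P = if p = 3 then 4 else 1 := by
  obtain ⟨a', rfl⟩ := hpa
  have hm : ¬ p ∣ a' * b ^ 2 := by
    intro hm
    have h1 : p ∣ a' * b := by
      rcases hp.dvd_mul.1 hm with h | h
      · exact h.mul_right _
      · exact (hp.dvd_of_dvd_pow h).mul_left _
    refine hp.not_isUnit (hab p ?_)
    rw [mul_assoc]
    exact mul_dvd_mul_left _ h1
  have h' : α ^ 3 = p * (a' * b ^ 2 : ℕ) := by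
    rw [h]
    push_cast
    ring
  split_ifs with hp3
  · subst hp3
    exact conductorExponent_eq_four hd hα hm (by exact_mod_cast h') (by exact_mod_cast hP)
  · exact conductorExponent_eq_one hd hα hp hp3 hm h' hP

theorem isConductor_radicandConductor (hd : Module.finrank F N = 3) {a b : ℕ}
    (hab : Squarefree (a * b)) {α : 𝓞 N} (hα : IsKummerGenerator F α) (h : α ^ 3 = a * b ^ 2) :
    IsConductor F N (Ideal.span {(radicandConductor a b : 𝓞 F)}) := by
  intro P
  change val (P.under (𝓞 F)) _ = _
  obtain ⟨p, hp, hpP⟩ := exists_prime_natCast_mem P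
  have hp' : (p : 𝓞 F) ∈ (P.under (𝓞 F)).asIdeal := by
    change algebraMap (𝓞 F) (𝓞 N) p ∈ P.asIdeal
    simpa using hpP
  have hb0 : b ≠ 0 := right_ne_zero_of_mul hab.ne_zero
  rw [val_natCast hp hp' (radicandConductor_ne_zero hab.ne_zero)]
  have hm0 : p ∣ a * b ^ 2 → p ∣ a * b := fun hm => by
    rcases hp.dvd_mul.1 hm with h | h
    · exact h.mul_right _
    · exact (hp.dvd_of_dvd_pow h).mul_left _
  by_cases hdvd : p ∣ a * b
  · have hexp : conductorExponent F N P = if p = 3 then 4 else 1 := by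
      rcases hp.dvd_mul.1 hdvd with hpa | hpb
      · exact conductorExponent_eq_val_of_dvd_left hd hab hα h hp hpP hpa
      · have hb0' : (b : 𝓞 N) ≠ 0 := by exact_mod_cast hb0
        -- Primes dividing `b` reduce to the previous case through `β = α² / b`, for which `β³ =
        -- ba²`.
        obtain ⟨β, hβ⟩ := exists_mul_eq_of_pow_eq (c := (b : 𝓞 N)) (x := α ^ 2) (n := 3)
          (y := b * a ^ 2) hb0' (by norm_num) (by
            calc (α ^ 2) ^ 3 = (α ^ 3) ^ 2 := by ring
              _ = _ := by rw [h]; ring)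
        refine conductorExponent_eq_val_of_dvd_left (α := β) (a := b) (b := a) hd (mul_comm a b ▸ hab)
          (hα.of_mul_eq_sq (c := b) (by simpa using hb0) (by simpa using hβ)) ?_ hp hpP hpb
        refine mul_left_cancel₀ (pow_ne_zero 3 hb0') ?_
        rw [← mul_pow, hβ]
        calc (α ^ 2) ^ 3 = (α ^ 3) ^ 2 := by ring
          _ = _ := by rw [h]; ring
    rw [hexp]
    split_ifs with hp3
    · subst hp3
      have h9 : ¬ (a * b ^ 2 % 9 = 1 ∨ a * b ^ 2 % 9 = 8) := by
        have : 3 ∣ a * b ^ 2 := hdvd.trans (mul_dvd_mul_left _ (dvd_pow_self _ two_ne_zero))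
        omega
      have h3 := val_three (P := P.under (𝓞 F)) (by exact_mod_cast hp')
      -- Now `9` divides `3ab` exactly, which gives exponent `2 · 2 = 4`.
      rw [radicandConductor, if_neg h9, Nat.factorization_mul (by norm_num) hab.ne_zero,
        Finsupp.add_apply, factorization_eq_one_of_squarefree hab hp hdvd, Nat.cast_ofNat, h3,
        Nat.prime_three.factorization_self]
      norm_num
    · rw [factorization_radicandConductor hab hp hp3, if_pos hdvd, val_natCast_prime hp hp3 hp']
      norm_num
  · rcases eq_or_ne p 3 with rfl | hp3
    · have h3 := val_three (P := P.under (𝓞 F)) (by exact_mod_cast hp')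
      have hm3 : ¬ 3 ∣ a * b ^ 2 := mt hm0 hdvd
      have hP3 : (3 : 𝓞 N) ∈ P.asIdeal := by exact_mod_cast hpP
      have hf0 := Nat.factorization_eq_zero_of_not_dvd hdvd
      -- Replacing `α` by `-α` if necessary makes the radicand `1` modulo `3`; then `ab² ≡ ±1 (mod
      -- 9)` means `3 ∣ u`.
      obtain ⟨u, β, hβ, hβu, hmu⟩ : ∃ (u : ℤ) (β : 𝓞 N), IsKummerGenerator F β ∧
          β ^ 3 = 1 + 3 * u ∧ ((a * b ^ 2 : ℕ) = 1 + 3 * u ∨ -(a * b ^ 2 : ℕ) = 1 + 3 * u) := by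
        have hcast : α ^ 3 = ((a * b ^ 2 : ℕ) : ℤ) := by
          rw [h]
          push_cast
          ring
        obtain ⟨u, hu⟩ : ∃ u : ℤ, ((a * b ^ 2 : ℕ) : ℤ) = 1 + 3 * u ∨
            -((a * b ^ 2 : ℕ) : ℤ) = 1 + 3 * u := by
          rcases (by omega : a * b ^ 2 % 3 = 1 ∨ a * b ^ 2 % 3 = 2) with h | h
          · exact ⟨(a * b ^ 2 : ℕ) / 3, by omega⟩
          · exact ⟨-((a * b ^ 2 : ℕ) / 3) - 1, by omega⟩
        rcases hu with hu | hu
        · exact ⟨u, α, hα, by rw [hcast, hu]; push_cast; ring, .inl hu⟩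
        · refine ⟨u, -α, hα.neg, ?_, .inr hu⟩
          rw [Odd.neg_pow (by decide), hcast, ← Int.cast_neg, hu]
          push_cast
          ring
      rw [Nat.cast_ofNat, h3, radicandConductor]
      split_ifs with h9
      · obtain ⟨v, rfl⟩ : 3 ∣ u := by omega
        rw [conductorExponent_eq_zero_of_modEq (u := v) hβ (by rw [hβu]; push_cast; ring) hP3, hf0]
        simp
      · have hu : ¬ 3 ∣ u := by omega
        rw [conductorExponent_eq_two hd hβ hu hβu hP3, Nat.factorization_mul (by norm_num) hab.ne_zero,
        Finsupp.add_apply, hf0, Nat.prime_three.factorization_self]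
        norm_num
    · rw [factorization_radicandConductor hab hp hp3, if_neg hdvd,
        conductorExponent_eq_zero_of_not_dvd hα]
      · simp
      · exact_mod_cast natCast_notMem_of_not_dvd (n := 3) hp hpP
          fun hd => hp3 ((Nat.prime_dvd_prime_iff_eq hp Nat.prime_three).1 hd)
      · intro hm
        refine natCast_notMem_of_not_dvd hp hpP (mt hm0 hdvd) ?_
        have : ((a * b ^ 2 : ℕ) : 𝓞 N) = α ^ 2 * α := by
          rw [← pow_succ, h]
          push_cast
          ring
        rw [this]
        exact Ideal.mul_mem_left _ _ hm

end Conductor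

end PureCubic

namespace PureCubic

/-! ### Radicands up to cubes, and cube roots inside a pure cubic field. -/

section Radicand

/-- Modulo `3` the exponent of `p` is `v(a) + 2v(b)`. As `v(a) + v(b) ≤ 1`, this residue determines
both. -/
theorem eq_and_eq_of_mul_sq_mul_cube_eq {a b c d u w : ℕ} (hab : Squarefree (a * b))
    (hcd : Squarefree (c * d)) (hu : u ≠ 0) (hw : w ≠ 0)
    (h : a * b ^ 2 * u ^ 3 = c * d ^ 2 * w ^ 3) : a = c ∧ b = d := by
  have ha := left_ne_zero_of_mul hab.ne_zero
  have hb := right_ne_zero_of_mul hab.ne_zero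
  have hc := left_ne_zero_of_mul hcd.ne_zero
  have hd := right_ne_zero_of_mul hcd.ne_zero
  have key : ∀ p, a.factorization p = c.factorization p ∧ b.factorization p = d.factorization p := by
    intro p
    have h1 := hab.natFactorization_le_one p
    have h2 := hcd.natFactorization_le_one p
    have h3 : (a * b ^ 2 * u ^ 3).factorization p = (c * d ^ 2 * w ^ 3).factorization p := by rw [h]
    rw [Nat.factorization_mul (by positivity) (by positivity),
      Nat.factorization_mul (by positivity) (by positivity),
      Nat.factorization_mul (by positivity) (by positivity),
      Nat.factorization_mul (by positivity) (by positivity)] at h3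
    rw [Nat.factorization_mul ha hb] at h1
    rw [Nat.factorization_mul hc hd] at h2
    simp only [Nat.factorization_pow, Finsupp.add_apply, Finsupp.smul_apply, smul_eq_mul] at h1 h2 h3
    omega
  exact ⟨Nat.eq_of_factorization_eq ha hc fun p => (key p).1,
    Nat.eq_of_factorization_eq hb hd fun p => (key p).2⟩

theorem eq_and_eq_of_eq_cube_mul {a b c d : ℕ} (hab : Squarefree (a * b))
    (hcd : Squarefree (c * d)) {q : ℚ} (h : (c * d ^ 2 : ℚ) = q ^ 3 * (a * b ^ 2)) :
    a = c ∧ b = d := by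
  have hc := left_ne_zero_of_mul hcd.ne_zero
  have hd := right_ne_zero_of_mul hcd.ne_zero
  have hq : q ≠ 0 := by
    rintro rfl
    have : (c * d ^ 2 : ℚ) ≠ 0 := by positivity
    exact this (by rw [h]; ring)
  refine eq_and_eq_of_mul_sq_mul_cube_eq (u := q.num.natAbs) (w := q.den) hab hcd
    (by simpa using hq) q.den_ne_zero ?_
  have hden : (q.den : ℚ) ≠ 0 := by exact_mod_cast q.den_ne_zero
  have h1 : (a * b ^ 2 * q.num ^ 3 : ℚ) = c * d ^ 2 * q.den ^ 3 := by
    rw [h]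
    nth_rewrite 2 [← Rat.num_div_den q]
    field_simp
  have h2 : (a * b ^ 2 * q.num ^ 3 : ℤ) = c * d ^ 2 * q.den ^ 3 := by exact_mod_cast h1
  have h3 := congrArg Int.natAbs h2
  simpa [Int.natAbs_mul, Int.natAbs_pow] using h3

/-- Multiplication by a prime `p` puts it into `a` if it is new, moves it from `a` to `b`, or moves
it from `b` to `c`. -/
theorem exists_eq_mul_sq_mul_cube (n : ℕ) (hn : n ≠ 0) :
    ∃ a b c : ℕ, Squarefree (a * b) ∧ n = a * b ^ 2 * c ^ 3 := by
  induction n using induction_on_primes with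
  | zero => exact absurd rfl hn
  | one => exact ⟨1, 1, 1, by simp, by simp⟩
  | prime_mul p n hp ih =>
    obtain ⟨a, b, c, hab, rfl⟩ := ih (right_ne_zero_of_mul hn)
    by_cases hpab : p ∣ a * b
    · rcases hp.dvd_mul.1 hpab with ⟨a', rfl⟩ | ⟨b', rfl⟩
      · exact ⟨a', p * b, c, by rwa [show a' * (p * b) = p * a' * b by ring], by ring⟩
      · exact ⟨a, b', p * c, hab.squarefree_of_dvd (mul_dvd_mul_left _ (dvd_mul_left _ _)), by ring⟩
    · refine ⟨p * a, b, c, ?_, by ring⟩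
      rw [mul_assoc, Nat.squarefree_mul ((Nat.Prime.coprime_iff_not_dvd hp).2 hpab)]
      exact ⟨hp.prime.squarefree, hab⟩

/-- The pairs `(a, b)` for which `∛(ab²)` generates a pure cubic field in normal form. -/
def IsRadicand (a b : ℕ) : Prop := Squarefree (a * b) ∧ ¬ (a = 1 ∧ b = 1)

theorem IsRadicand.symm {a b : ℕ} (h : IsRadicand a b) : IsRadicand b a :=
  ⟨mul_comm a b ▸ h.1, fun h' => h.2 h'.symm⟩

theorem IsRadicand.ne {a b : ℕ} (h : IsRadicand a b) : a ≠ b := by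
  rintro rfl
  have : a = 1 := Nat.isUnit_iff.1 (h.1 a dvd_rfl)
  exact h.2 ⟨this, this⟩

theorem IsRadicand.cube_ne {a b : ℕ} (h : IsRadicand a b) (q : ℚ) : q ^ 3 ≠ a * b ^ 2 := by
  intro hq
  refine h.2 ?_
  have := eq_and_eq_of_eq_cube_mul (a := 1) (b := 1) (q := q) (by simp) h.1 (by rw [← hq]; simp)
  exact ⟨this.1.symm, this.2.symm⟩

variable {E : Type*} [Field E] [Algebra ℚ E]

theorem minpoly_of_cube_eq {θ : E} {m : ℚ} (hm : ∀ q : ℚ, q ^ 3 ≠ m)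
    (hθ : θ ^ 3 = algebraMap ℚ E m) : minpoly ℚ θ = .X ^ 3 - .C m := by
  refine (minpoly.eq_of_irreducible_of_monic
    (X_pow_sub_C_irreducible_of_prime Nat.prime_three hm) ?_
    (Polynomial.monic_X_pow_sub_C m three_ne_zero)).symm
  simp [hθ]

theorem natDegree_minpoly_of_cube_eq {θ : E} {m : ℚ} (hm : ∀ q : ℚ, q ^ 3 ≠ m)
    (hθ : θ ^ 3 = algebraMap ℚ E m) : (minpoly ℚ θ).natDegree = 3 := by
  rw [minpoly_of_cube_eq hm hθ, Polynomial.natDegree_X_pow_sub_C]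

theorem isIntegral_of_cube_eq {θ : E} {m : ℚ} (hθ : θ ^ 3 = algebraMap ℚ E m) : IsIntegral ℚ θ :=
  IsIntegral.of_pow (n := 3) (by norm_num) (hθ ▸ isIntegral_algebraMap)

theorem finrank_adjoin_of_cube_eq {θ : E} {m : ℚ} (hm : ∀ q : ℚ, q ^ 3 ≠ m)
    (hθ : θ ^ 3 = algebraMap ℚ E m) : Module.finrank ℚ (IntermediateField.adjoin ℚ {θ}) = 3 := by
  rw [IntermediateField.adjoin.finrank (isIntegral_of_cube_eq hθ),
    natDegree_minpoly_of_cube_eq hm hθ]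

theorem coeff_eq_zero_of_cube_eq {θ : E} {m : ℚ} (hm : ∀ q : ℚ, q ^ 3 ≠ m)
    (hθ : θ ^ 3 = algebraMap ℚ E m) {x y z : ℚ}
    (h : algebraMap ℚ E x + algebraMap ℚ E y * θ + algebraMap ℚ E z * θ ^ 2 = 0) :
    x = 0 ∧ y = 0 ∧ z = 0 := by
  have hp : (Polynomial.C z * .X ^ 2 + .C y * .X + .C x : Polynomial ℚ) = 0 := by
    refine Polynomial.eq_zero_of_dvd_of_degree_lt (p := minpoly ℚ θ) (minpoly.dvd ℚ θ ?_) ?_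
    · simp only [map_add, map_mul, Polynomial.aeval_C, map_pow, Polynomial.aeval_X]
      linear_combination h
    · rw [minpoly_of_cube_eq hm hθ, Polynomial.degree_X_pow_sub_C (by norm_num)]
      exact Polynomial.degree_quadratic_lt
  have h0 := congrArg (Polynomial.coeff · 0) hp
  have h1 := congrArg (Polynomial.coeff · 1) hp
  have h2 := congrArg (Polynomial.coeff · 2) hp
  simp [Polynomial.coeff_X, Polynomial.coeff_C] at h0 h1 h2
  exact ⟨h0, h1, h2⟩

theorem exists_coeff_of_mem_adjoin {θ : E} {m : ℚ} (hm : ∀ q : ℚ, q ^ 3 ≠ m)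
    (hθ : θ ^ 3 = algebraMap ℚ E m) {t : E} (ht : t ∈ IntermediateField.adjoin ℚ {θ}) :
    ∃ x y z : ℚ, t = algebraMap ℚ E x + algebraMap ℚ E y * θ + algebraMap ℚ E z * θ ^ 2 := by
  have hint := isIntegral_of_cube_eq hθ
  rw [← IntermediateField.mem_toSubalgebra,
    IntermediateField.adjoin_simple_toSubalgebra_of_isAlgebraic hint.isAlgebraic,
    Algebra.adjoin_singleton_eq_range_aeval] at ht
  obtain ⟨f, rfl⟩ := ht
  set g := f %ₘ minpoly ℚ θ with hg
  have hdeg : g.natDegree < 3 := by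
    rw [← natDegree_minpoly_of_cube_eq hm hθ]
    exact Polynomial.natDegree_modByMonic_lt _ (minpoly.monic hint) (minpoly.ne_one ℚ θ)
  refine ⟨g.coeff 0, g.coeff 1, g.coeff 2, ?_⟩
  have h1 : Polynomial.aeval θ f = Polynomial.aeval θ g :=
    (Polynomial.aeval_modByMonic_eq_self_of_root (minpoly.aeval ℚ θ)).symm
  change Polynomial.aeval θ f = _
  rw [h1, Polynomial.aeval_eq_sum_range' hdeg]
  simp [Finset.sum_range_succ, Algebra.smul_def]

/-- If the pure cubic field `ℚ(∛m)` contains a cube root of `n`, then `n / m` or `n / m²` is a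
cube. -/
theorem exists_eq_cube_mul {θ θ' : E} {m n : ℚ} (hm : ∀ q : ℚ, q ^ 3 ≠ m) (hn : ∀ q : ℚ, q ^ 3 ≠ n)
    (hθ : θ ^ 3 = algebraMap ℚ E m) (hθ' : θ' ^ 3 = algebraMap ℚ E n)
    (hmem : θ' ∈ IntermediateField.adjoin ℚ {θ}) :
    ∃ q : ℚ, n = q ^ 3 * m ∨ n = q ^ 3 * m ^ 2 := by
  obtain ⟨x, y, z, rfl⟩ := exists_coeff_of_mem_adjoin hm hθ hmem
  have hm0 : m ≠ 0 := fun h => hm 0 (by simp [h])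
  obtain ⟨hA, hB, hC⟩ := coeff_eq_zero_of_cube_eq hm hθ
    -- The coordinates of `(x + yθ + zθ²)³ - n` in the basis `1, θ, θ²`.
    (x := x ^ 3 + m * y ^ 3 + m ^ 2 * z ^ 3 + 6 * m * x * y * z - n)
    (y := 3 * (x ^ 2 * y + m * x * z ^ 2 + m * y ^ 2 * z))
    (z := 3 * (x ^ 2 * z + x * y ^ 2 + m * y * z ^ 2)) (by
      simp only [map_add, map_sub, map_mul, map_pow, map_ofNat]
      generalize algebraMap ℚ E x = x at *
      generalize algebraMap ℚ E y = y at *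
      generalize algebraMap ℚ E z = z at *
      rw [← hθ, ← hθ']
      ring)
  -- Either `x = 0`, and then `y` or `z` vanishes too, or `m z³ = y³`. The latter makes `m` a cube,
  -- or `n = x³` when `y = z = 0`.
  have hx : x * (m * z ^ 3 - y ^ 3) = 0 := by linear_combination (z * hB - y * hC) / 3
  rcases mul_eq_zero.1 hx with rfl | hx
  · have h1 : m * y ^ 2 * z = 0 := by linear_combination hB / 3
    rcases mul_eq_zero.1 h1 with h1 | rfl
    · obtain rfl : y = 0 := by simpa [hm0] using h1
      exact ⟨z, .inr (by linear_combination -hA)⟩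
    · exact ⟨y, .inl (by linear_combination -hA)⟩
  · by_cases hz : z = 0
    · subst hz
      obtain rfl : y = 0 := by simpa using hx
      exact absurd (by linear_combination hA) (hn x)
    · refine absurd ?_ (hm (y / z))
      field_simp
      linear_combination -hx

end Radicand

end PureCubic

namespace PureCubic

/-! ### Normal form of pure cubic fields, and their Galois closures. -/

section ClosureStructure

theorem exists_isRadicand_of_isPureCubic {K : Type*} [Field K] [Algebra ℚ K] (h : IsPureCubic K) :
    ∃ a b : ℕ, IsRadicand a b ∧ ∃ η : K, η ^ 3 = a * b ^ 2 := by
  obtain ⟨hd, m, θ, hθ, htop⟩ := h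
  have : CharZero K := algebraRat.charZero K
  have : FiniteDimensional ℚ K := Module.finite_of_finrank_pos (by omega)
  have hdeg : (minpoly ℚ θ).natDegree = 3 :=
    ((Field.primitive_element_iff_minpoly_natDegree_eq ℚ θ).1 htop).trans hd
  -- Otherwise `X³ - m` splits off a linear factor and `θ` has degree at most `2`.
  have hncube : ∀ q : ℚ, q ^ 3 ≠ m := by
    intro q hq
    have h1 : (θ - algebraMap ℚ K q) *
        (θ ^ 2 + algebraMap ℚ K q * θ + algebraMap ℚ K q ^ 2) = 0 := by
      have : algebraMap ℚ K q ^ 3 = m := by rw [← map_pow, hq, map_intCast]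
      linear_combination hθ - this
    rcases mul_eq_zero.1 h1 with h1 | h1
    · rw [sub_eq_zero.1 h1, minpoly.eq_X_sub_C, Polynomial.natDegree_X_sub_C] at hdeg
      omega
    · have h2 : minpoly ℚ θ ∣ .X ^ 2 + .C q * .X + .C (q ^ 2) := by
        refine minpoly.dvd ℚ θ ?_
        simpa using h1
      have h3 := Polynomial.natDegree_le_of_dvd h2 (Polynomial.Monic.ne_zero (by monicity!))
      have h4 : (Polynomial.X ^ 2 + .C q * .X + .C (q ^ 2) : Polynomial ℚ).natDegree ≤ 2 := by
        compute_degree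
      omega
  have hm0 : m ≠ 0 := by
    rintro rfl
    exact hncube 0 (by simp)
  obtain ⟨a, b, c, hab, hn⟩ := exists_eq_mul_sq_mul_cube m.natAbs (by simpa using hm0)
  have hc : (c : K) ≠ 0 := by
    have : c ≠ 0 := by
      rintro rfl
      simp at hn
      exact hm0 hn
    exact_mod_cast this
  -- The sign of `m` is itself a cube, so it is absorbed into the generator.
  obtain ⟨e, he, hme⟩ : ∃ e : ℤ, e ^ 3 * e ^ 3 = 1 ∧ m = e ^ 3 * m.natAbs := by
    rcases Int.natAbs_eq m with h | h
    · exact ⟨1, by norm_num, by simpa using h⟩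
    · exact ⟨-1, by norm_num, by linarith⟩
  refine ⟨a, b, ⟨hab, ?_⟩, e * θ / c, ?_⟩
  · rintro ⟨rfl, rfl⟩
    refine hncube (e * c) ?_
    rw [hme, hn]
    push_cast
    ring
  · have hm : (m : K) = e ^ 3 * (a * b ^ 2 * c ^ 3) := by
      have := congrArg (Int.cast (R := K)) hme
      rw [hn] at this
      exact_mod_cast this
    have he' : (e : K) ^ 3 * e ^ 3 = 1 := by exact_mod_cast congrArg (Int.cast (R := K)) he
    rw [div_pow, mul_pow, hθ, hm]
    field_simp
    linear_combination (a * b ^ 2 : K) * he'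

variable {K : Type*} [Field K] [Algebra ℚ K]

theorem algebraMap_radicand {a b : ℕ} : algebraMap ℚ K (a * b ^ 2) = a * b ^ 2 := by
  rw [map_mul, map_pow, map_natCast, map_natCast]

theorem adjoin_eq_top_of_cube_eq (hd : Module.finrank ℚ K = 3) {m : ℚ} (hm : ∀ q : ℚ, q ^ 3 ≠ m)
    {η : K} (hη : η ^ 3 = algebraMap ℚ K m) : IntermediateField.adjoin ℚ {η} = ⊤ := by
  have : FiniteDimensional ℚ K := Module.finite_of_finrank_pos (by omega)
  rw [Field.primitive_element_iff_minpoly_natDegree_eq, hd, natDegree_minpoly_of_cube_eq hm hη]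

theorem isPureCubic_of_cube_eq (hd : Module.finrank ℚ K = 3) {a b : ℕ} (h : IsRadicand a b)
    {η : K} (hη : η ^ 3 = a * b ^ 2) : IsPureCubic K :=
  ⟨hd, (a * b ^ 2 : ℕ), η, by simpa using hη,
    adjoin_eq_top_of_cube_eq hd h.cube_ne (by rw [hη, algebraMap_radicand])⟩

theorem exists_cube_eq_symm {a b : ℕ} (h : IsRadicand a b) {η : K} (hη : η ^ 3 = a * b ^ 2) :
    ∃ η' : K, η' ^ 3 = b * a ^ 2 := by
  have : CharZero K := algebraRat.charZero K
  have hb : (b : K) ≠ 0 := by exact_mod_cast right_ne_zero_of_mul h.1.ne_zero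
  refine ⟨η ^ 2 / b, ?_⟩
  rw [div_pow, ← pow_mul, mul_comm 2 3, pow_mul, hη]
  field_simp

theorem eq_or_eq_symm_of_cube_eq (hd : Module.finrank ℚ K = 3) {a b c d : ℕ} (h : IsRadicand a b)
    (h' : IsRadicand c d) {η η' : K} (hη : η ^ 3 = a * b ^ 2) (hη' : η' ^ 3 = c * d ^ 2) :
    (a = c ∧ b = d) ∨ (b = c ∧ a = d) := by
  rw [← algebraMap_radicand] at hη hη'
  obtain ⟨q, hq | hq⟩ := exists_eq_cube_mul h.cube_ne h'.cube_ne hη hη'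
    (by rw [adjoin_eq_top_of_cube_eq hd h.cube_ne hη]; trivial)
  · exact .inl (eq_and_eq_of_eq_cube_mul h.1 h'.1 hq)
  -- Since `(ab²)² = b³ · ba²`, the square of the radicand has the swapped normal form.
  · exact .inr (eq_and_eq_of_eq_cube_mul (q := q * b) h.symm.1 h'.1 (by rw [hq]; ring))

theorem algebraAdjoin_eq_top_of_cube_eq (hd : Module.finrank ℚ K = 3) {m : ℚ}
    (hm : ∀ q : ℚ, q ^ 3 ≠ m) {η : K} (hη : η ^ 3 = algebraMap ℚ K m) :
    Algebra.adjoin ℚ {η} = ⊤ := by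
  rw [← IntermediateField.adjoin_simple_toSubalgebra_of_isAlgebraic
    (isIntegral_of_cube_eq hη).isAlgebraic, adjoin_eq_top_of_cube_eq hd hm hη,
    IntermediateField.top_toSubalgebra]

theorem nonempty_algEquiv_of_cube_eq {K' : Type*} [Field K'] [Algebra ℚ K']
    (hd : Module.finrank ℚ K = 3) (hd' : Module.finrank ℚ K' = 3) {m : ℚ} (hm : ∀ q : ℚ, q ^ 3 ≠ m)
    {η : K} {η' : K'} (hη : η ^ 3 = algebraMap ℚ K m) (hη' : η' ^ 3 = algebraMap ℚ K' m) :
    Nonempty (K ≃ₐ[ℚ] K') := by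
  exact ⟨(PowerBasis.ofAdjoinEqTop (isIntegral_of_cube_eq hη)
    (algebraAdjoin_eq_top_of_cube_eq hd hm hη)).equivOfMinpoly
    (PowerBasis.ofAdjoinEqTop (isIntegral_of_cube_eq hη')
      (algebraAdjoin_eq_top_of_cube_eq hd' hm hη'))
    (by simp [minpoly_of_cube_eq hm hη, minpoly_of_cube_eq hm hη'])⟩

theorem isAlgebraic_algebraicClosure : Algebra.IsAlgebraic ℚ (AlgebraicClosure ℚ) := by
  convert AlgebraicClosure.isAlgebraic ℚ
  · rfl
  · exact Subsingleton.elim _ _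

theorem normal_algebraicClosure : Normal ℚ (AlgebraicClosure ℚ) :=
  have := isAlgebraic_algebraicClosure
  normal_iff.2 fun x => ⟨Algebra.IsIntegral.isIntegral x, IsAlgClosed.splits _⟩

/-- Every embedding sends `η` to `θ`, `ωθ` or `ω²θ`. Conversely `ωθ` is conjugate to `θ`, so the
closure contains `ωθ / θ = ω`. -/
theorem exists_galoisClosure_eq (hd : Module.finrank ℚ K = 3) {m : ℚ} (hm : ∀ q : ℚ, q ^ 3 ≠ m)
    {η : K} (hη : η ^ 3 = algebraMap ℚ K m) :
    ∃ ω θ : AlgebraicClosure ℚ, ω ^ 2 + ω + 1 = 0 ∧ θ ^ 3 = algebraMap ℚ _ m ∧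
      galoisClosure K = IntermediateField.adjoin ℚ {ω, θ} := by
  have htop := adjoin_eq_top_of_cube_eq hd hm hη
  have : FiniteDimensional ℚ K := Module.finite_of_finrank_pos (by omega)
  have hm0 : m ≠ 0 := fun h => hm 0 (by simp [h])
  obtain ⟨ω, hω⟩ : ∃ ω : AlgebraicClosure ℚ, ω ^ 2 + ω + 1 = 0 := by
    obtain ⟨ω, hω⟩ := IsAlgClosed.exists_root
      (Polynomial.X ^ 2 + Polynomial.X + 1 : Polynomial (AlgebraicClosure ℚ)) (by
        rw [show (Polynomial.X ^ 2 + Polynomial.X + 1 : Polynomial (AlgebraicClosure ℚ)).degree = 2 by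
          compute_degree!]
        norm_num)
    exact ⟨ω, by simpa using hω⟩
  let ι : K →ₐ[ℚ] AlgebraicClosure ℚ := IsAlgClosed.lift
  have hθ : (ι η) ^ 3 = algebraMap ℚ _ m := by rw [← map_pow, hη, AlgHom.commutes]
  have hθ0 : ι η ≠ 0 := by
    intro h0
    rw [h0] at hθ
    exact hm0 (by simpa using hθ.symm)
  have hω3 : ω ^ 3 = 1 := by linear_combination (ω - 1) * hω
  have hωθ : (ω * ι η) ^ 3 = algebraMap ℚ _ m := by rw [mul_pow, hω3, one_mul, hθ]
  refine ⟨ω, ι η, hω, hθ, le_antisymm (iSup_le fun f => ?_) ?_⟩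
  · have hf : (f η) ^ 3 = algebraMap ℚ _ m := by rw [← map_pow, hη, AlgHom.commutes]
    have hω' : ω ∈ IntermediateField.adjoin ℚ {ω, ι η} :=
      IntermediateField.subset_adjoin _ _ (by simp)
    have hθ' : ι η ∈ IntermediateField.adjoin ℚ {ω, ι η} :=
      IntermediateField.subset_adjoin _ _ (by simp)
    have hmem : f η ∈ IntermediateField.adjoin ℚ {ω, ι η} := by
      have h1 : (f η - ι η) * ((f η - ω * ι η) * (f η - ω ^ 2 * ι η)) = 0 := by
        linear_combination hf - hθ + (-(f η) ^ 2 * ι η + ω * f η * (ι η) ^ 2 - (ω - 1) * (ι η) ^ 3) * hω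
      rcases mul_eq_zero.1 h1 with h1 | h1
      · rwa [sub_eq_zero.1 h1]
      · rcases mul_eq_zero.1 h1 with h1 | h1 <;> rw [sub_eq_zero.1 h1]
        · exact mul_mem hω' hθ'
        · exact mul_mem (pow_mem hω' 2) hθ'
    rw [AlgHom.fieldRange_eq_map, ← htop, IntermediateField.adjoin_map, Set.image_singleton]
    simpa using hmem
  · have := normal_algebraicClosure
    have h1 : ι η ∈ galoisClosure K := AlgHom.fieldRange_le_normalClosure ι ⟨η, rfl⟩
    have h2 : ω * ι η ∈ galoisClosure K := by
      obtain ⟨σ, hσ⟩ := minpoly.exists_algEquiv_of_root (K := ℚ) (x := ι η) (y := ω * ι η)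
        (isIntegral_of_cube_eq hωθ).isAlgebraic (by
          rw [minpoly_of_cube_eq hm hωθ]
          simp [hθ])
      refine AlgHom.fieldRange_le_normalClosure (σ.toAlgHom.comp ι) ⟨η, ?_⟩
      exact hσ
    rw [IntermediateField.adjoin_le_iff]
    rintro x (rfl | rfl)
    · have h3 := div_mem h2 h1
      rwa [mul_div_cancel_right₀ _ hθ0] at h3
    · exact h1

end ClosureStructure

end PureCubic

namespace PureCubic

/-! ### The quadratic subfield and the conductor of a pure cubic field. -/

section QuadraticSubfield

variable {N : Type*} [Field N] [CharZero N]

theorem isPrimitiveRoot_of_sq_add_add_one_eq_zero {ω : N} (hω : ω ^ 2 + ω + 1 = 0) :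
    IsPrimitiveRoot ω 3 := by
  rw [← Polynomial.isRoot_cyclotomic_iff]
  simp [Polynomial.cyclotomic_three, hω]

theorem isCyclotomicExtension_adjoin {ω : N} (hω : ω ^ 2 + ω + 1 = 0) [Algebra.IsIntegral ℚ N] :
    IsCyclotomicExtension {3} ℚ (IntermediateField.adjoin ℚ {ω}) := by
  convert (isPrimitiveRoot_of_sq_add_add_one_eq_zero hω).intermediateField_adjoin_isCyclotomicExtension ℚ
  · rfl
  · exact Subsingleton.elim _ _

theorem finrank_adjoin_of_sq_add_add_one_eq_zero {ω : N} (hω : ω ^ 2 + ω + 1 = 0)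
    [Algebra.IsIntegral ℚ N] : Module.finrank ℚ (IntermediateField.adjoin ℚ {ω}) = 2 := by
  rw [IntermediateField.adjoin.finrank (Algebra.IsIntegral.isIntegral ω),
    ← Polynomial.cyclotomic_eq_minpoly_rat (isPrimitiveRoot_of_sq_add_add_one_eq_zero hω) (by norm_num),
    Polynomial.natDegree_cyclotomic]
  rfl

variable {ω θ : N} {m : ℚ}

theorem adjoin_adjoin_eq_top (htop : IntermediateField.adjoin ℚ {ω, θ} = ⊤) :
    IntermediateField.adjoin (IntermediateField.adjoin ℚ {ω}) {θ} = ⊤ := by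
  have h := IntermediateField.adjoin_adjoin_left ℚ {ω} {θ}
  rw [Set.singleton_union, htop] at h
  exact IntermediateField.restrictScalars_injective ℚ (h.trans rfl)

/-- The degree is at most `3` because `θ` generates. It is divisible by `3` because `ℚ(θ) ⊆ N` has
degree `3`, coprime to `2`. -/
theorem finrank_adjoin_eq_three (hω : ω ^ 2 + ω + 1 = 0) (hm : ∀ q : ℚ, q ^ 3 ≠ m)
    (hθ : θ ^ 3 = algebraMap ℚ N m) (htop : IntermediateField.adjoin ℚ {ω, θ} = ⊤)
    [FiniteDimensional ℚ N] :
    Module.finrank (IntermediateField.adjoin ℚ {ω}) N = 3 := by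
  set F := IntermediateField.adjoin ℚ {ω} with hF
  have h2 : Module.finrank ℚ F = 2 := finrank_adjoin_of_sq_add_add_one_eq_zero hω
  have h1 := Module.finrank_mul_finrank ℚ F N
  have h3 : 3 ∣ Module.finrank ℚ N := by
    have := Module.finrank_mul_finrank ℚ (IntermediateField.adjoin ℚ {θ}) N
    rw [finrank_adjoin_of_cube_eq hm hθ] at this
    exact ⟨_, this.symm⟩
  have hle : Module.finrank F N ≤ 3 := by
    have h4 : Module.finrank F N = (minpoly F θ).natDegree :=
      ((Field.primitive_element_iff_minpoly_natDegree_eq F θ).1 (adjoin_adjoin_eq_top htop)).symm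
    have h5 : minpoly F θ ∣ .X ^ 3 - .C (algebraMap ℚ F m) := by
      refine minpoly.dvd F θ ?_
      simp [hθ]
    rw [h4]
    refine (Polynomial.natDegree_le_of_dvd h5
      (Polynomial.monic_X_pow_sub_C _ three_ne_zero).ne_zero).trans ?_
    rw [Polynomial.natDegree_X_pow_sub_C]
  have hpos : 0 < Module.finrank F N := Module.finrank_pos
  rw [h2] at h1
  omega

/-- Over `F` the degree of `ω` is at most `2` and divides `[N : F] = 3`, so `ω ∈ F`. -/
theorem eq_adjoin_of_finrank_eq_two (hω : ω ^ 2 + ω + 1 = 0) (hm : ∀ q : ℚ, q ^ 3 ≠ m)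
    (hθ : θ ^ 3 = algebraMap ℚ N m) (htop : IntermediateField.adjoin ℚ {ω, θ} = ⊤)
    [FiniteDimensional ℚ N] {F : IntermediateField ℚ N} (hF : Module.finrank ℚ F = 2) :
    F = IntermediateField.adjoin ℚ {ω} := by
  have h6 : Module.finrank F N = 3 := by
    have h1 := Module.finrank_mul_finrank ℚ F N
    have h2 := Module.finrank_mul_finrank ℚ (IntermediateField.adjoin ℚ {ω}) N
    rw [finrank_adjoin_eq_three hω hm hθ htop, finrank_adjoin_of_sq_add_add_one_eq_zero hω] at h2
    rw [hF] at h1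
    omega
  have h3 : (minpoly F ω).natDegree ∣ 3 := by
    rw [← h6, ← IntermediateField.adjoin.finrank (Algebra.IsIntegral.isIntegral ω)]
    exact ⟨_, (Module.finrank_mul_finrank F (IntermediateField.adjoin F {ω}) N).symm⟩
  have h4 : (minpoly F ω).natDegree ≤ 2 := by
    have h5 : minpoly F ω ∣ .X ^ 2 + .X + 1 := by
      refine minpoly.dvd F ω ?_
      simpa using hω
    refine (Polynomial.natDegree_le_of_dvd h5 (Polynomial.Monic.ne_zero (by monicity!))).trans ?_
    compute_degree
  have h5 : (minpoly F ω).natDegree = 1 := by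
    rcases (Nat.dvd_prime Nat.prime_three).1 h3 with h | h
    · exact h
    · omega
  have h7 : ω ∈ F := by
    obtain ⟨x, hx⟩ := minpoly.natDegree_eq_one_iff.1 h5
    rw [← hx]
    exact x.2
  symm
  refine IntermediateField.eq_of_le_of_finrank_eq (by simpa using h7) ?_
  rw [hF, finrank_adjoin_of_sq_add_add_one_eq_zero hω]

theorem isConductor_adjoin [NumberField N] [IsGalois ℚ N] {a b : ℕ} (hab : IsRadicand a b)
    (hω : ω ^ 2 + ω + 1 = 0)
    (hθ : θ ^ 3 = a * b ^ 2) (htop : IntermediateField.adjoin ℚ {ω, θ} = ⊤) :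
    IsConductor (IntermediateField.adjoin ℚ {ω}) N
      (Ideal.span {(radicandConductor a b : 𝓞 (IntermediateField.adjoin ℚ {ω}))}) := by
  set F := IntermediateField.adjoin ℚ {ω} with hF
  have hθ' : θ ^ 3 = algebraMap ℚ N (a * b ^ 2) := by rw [algebraMap_radicand, hθ]
  have hd : Module.finrank F N = 3 := finrank_adjoin_eq_three hω hab.cube_ne hθ' htop
  have : NumberField F := inferInstance
  have : IsCyclotomicExtension {3} ℚ F := isCyclotomicExtension_adjoin hω
  have : Nontrivial (N ≃ₐ[F] N) := by
    rw [← Finite.one_lt_card_iff_nontrivial, IsGalois.card_aut_eq_finrank, hd]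
    norm_num
  have hθi : IsIntegral ℤ θ := .of_pow (n := 3) (by norm_num) (by
    rw [hθ]
    exact_mod_cast isIntegral_algebraMap (R := ℤ) (A := N) (x := (a * b ^ 2 : ℕ)))
  let α : 𝓞 N := ⟨θ, hθi⟩
  have hα : α ^ 3 = a * b ^ 2 := RingOfIntegers.ext hθ
  refine isConductor_radicandConductor hd hab.1 (α := α) ?_ hα
  refine isKummerGenerator_of_pow_three_eq (n := (a * b ^ 2 : ℕ)) (by rw [hα]; push_cast; rfl)
    exists_sq_add_add_one_eq_zero fun τ hτ => ?_
  have hτθ : τ θ = θ := congrArg (algebraMap (𝓞 N) N) hτ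
  refine AlgEquiv.ext fun x => ?_
  have hx : x ∈ IntermediateField.adjoin F {θ} := by
    rw [adjoin_adjoin_eq_top htop]
    trivial
  induction hx using IntermediateField.adjoin_induction with
  | mem x hx => rw [Set.mem_singleton_iff.1 hx, hτθ]; rfl
  | algebraMap x => exact τ.commutes x
  | add x y _ _ hx hy => rw [map_add, hx, hy]; rfl
  | inv x _ hx => rw [map_inv₀, hx]; rfl
  | mul x y _ _ hx hy => rw [map_mul, hx, hy]; rfl

theorem isResolventConductor_iff [NumberField N] [IsGalois ℚ N] {a b : ℕ} (hab : IsRadicand a b)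
    (hω : ω ^ 2 + ω + 1 = 0)
    (hθ : θ ^ 3 = a * b ^ 2) (htop : IntermediateField.adjoin ℚ {ω, θ} = ⊤) (f : ℕ) :
    IsResolventConductor N f ↔ f = radicandConductor a b := by
  have hθ' : θ ^ 3 = algebraMap ℚ N (a * b ^ 2) := by rw [algebraMap_radicand, hθ]
  have hc := isConductor_adjoin hab hω hθ htop
  have h0 := radicandConductor_ne_zero hab.1.ne_zero
  have : IsCyclotomicExtension {3} ℚ (IntermediateField.adjoin ℚ {ω}) :=
    isCyclotomicExtension_adjoin hω
  constructor
  · rintro ⟨hf, F, hF, hcond⟩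
    obtain rfl := eq_adjoin_of_finrank_eq_two hω hab.cube_ne hθ' htop hF
    exact isConductor_unique hf.ne' h0 hcond hc
  · rintro rfl
    exact ⟨Nat.pos_of_ne_zero h0, _, finrank_adjoin_of_sq_add_add_one_eq_zero hω, hc⟩

end QuadraticSubfield

theorem numberField_galoisClosure (K : Type*) [Field K] [Algebra ℚ K] [FiniteDimensional ℚ K] :
    NumberField (galoisClosure K) where
  to_finiteDimensional := by
    convert normalClosure.is_finiteDimensional ℚ K (AlgebraicClosure ℚ)

theorem isGalois_galoisClosure (K : Type*) [Field K] [Algebra ℚ K] [FiniteDimensional ℚ K] :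
    IsGalois ℚ (galoisClosure K) where
  to_isSeparable := by
    have := numberField_galoisClosure K
    infer_instance
  to_normal := by
    have := normal_algebraicClosure
    convert normalClosure.normal ℚ K (AlgebraicClosure ℚ)
    exact Subsingleton.elim _ _

theorem isCubicConductor_iff {K : Type*} [Field K] [Algebra ℚ K] (hd : Module.finrank ℚ K = 3)
    {a b : ℕ} (hab : IsRadicand a b) {η : K} (hη : η ^ 3 = a * b ^ 2) (f : ℕ) :
    IsCubicConductor K f ↔ f = radicandConductor a b := by
  obtain ⟨ω, θ, hω, hθ, hN⟩ := exists_galoisClosure_eq hd hab.cube_ne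
    (hη.trans algebraMap_radicand.symm)
  rw [algebraMap_radicand] at hθ
  have : FiniteDimensional ℚ K := Module.finite_of_finrank_pos (by omega)
  have := numberField_galoisClosure K
  have := isGalois_galoisClosure K
  have hωN : ω ∈ galoisClosure K := hN ▸ IntermediateField.subset_adjoin _ _ (by simp)
  have hθN : θ ∈ galoisClosure K := hN ▸ IntermediateField.subset_adjoin _ _ (by simp)
  refine isResolventConductor_iff (N := galoisClosure K) (ω := ⟨ω, hωN⟩) (θ := ⟨θ, hθN⟩) hab
    (Subtype.ext hω) (Subtype.ext hθ) ?_ f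
  let φ : galoisClosure K →ₐ[ℚ] AlgebraicClosure ℚ :=
    (algebraMap (galoisClosure K) (AlgebraicClosure ℚ)).toRatAlgHom
  refine IntermediateField.map_injective φ ?_
  rw [IntermediateField.adjoin_map, Set.image_pair]
  change IntermediateField.adjoin ℚ {ω, θ} = _
  rw [← hN]
  ext x
  exact ⟨fun hx => ⟨⟨x, hx⟩, trivial, rfl⟩, fun ⟨y, _, hy⟩ => hy ▸ y.2⟩

theorem cubicConductor_eq {K : Type*} [Field K] [Algebra ℚ K] (hd : Module.finrank ℚ K = 3)
    {a b : ℕ} (hab : IsRadicand a b) {η : K} (hη : η ^ 3 = a * b ^ 2) :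
    cubicConductor K = radicandConductor a b := by
  simp [cubicConductor, isCubicConductor_iff hd hab hη]

end PureCubic

namespace PureCubic

/-! ### Euler products for sums over pairs with squarefree product. -/

section DirichletSeries

/-- The Dirichlet series term attached to a pair `(a, b)` with `ab` squarefree, twisted by
`c(a) c(b)²`. -/
noncomputable def pairTerm (c : ℕ →* ℂ) (s : ℂ) (x : ℕ × ℕ) : ℂ :=
  if Squarefree (x.1 * x.2) then c x.1 * c x.2 ^ 2 * ((x.1 * x.2 : ℕ) : ℂ) ^ (-s) else 0

/-- A completely multiplicative function as an arithmetic function. -/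
noncomputable def toArith (c : ℕ →* ℂ) : ArithmeticFunction ℂ :=
  ⟨fun n => if n = 0 then 0 else c n, by simp⟩

theorem toArith_apply (c : ℕ →* ℂ) {n : ℕ} (hn : n ≠ 0) : toArith c n = c n := if_neg hn

theorem isMultiplicative_toArith (c : ℕ →* ℂ) : (toArith c).IsMultiplicative := by
  rw [ArithmeticFunction.IsMultiplicative.iff_ne_zero]
  refine ⟨by simp [toArith_apply], fun hm hn _ => ?_⟩
  rw [toArith_apply _ (mul_ne_zero hm hn), toArith_apply _ hm, toArith_apply _ hn, map_mul]

/-- The sum of the terms `pairTerm c s (a, b)` over `ab = n`. -/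
noncomputable def collectedTerm (c : ℕ →* ℂ) (s : ℂ) (n : ℕ) : ℂ :=
  if Squarefree n then (toArith c * toArith (c ^ 2)) n * (n : ℂ) ^ (-s) else 0

theorem tsum_fiber_pairTerm (c : ℕ →* ℂ) (s : ℂ) (n : ℕ) :
    ∑' x : (fun x : ℕ × ℕ => x.1 * x.2) ⁻¹' {n}, pairTerm c s x = collectedTerm c s n := by
  rw [collectedTerm]
  split_ifs with hn
  · have hset : (fun x : ℕ × ℕ => x.1 * x.2) ⁻¹' {n} = ↑(n.divisorsAntidiagonal) := by
      ext x
      simp [hn.ne_zero]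
    rw [hset, Finset.tsum_subtype', ArithmeticFunction.mul_apply, Finset.sum_mul]
    refine Finset.sum_congr rfl fun x hx => ?_
    obtain ⟨rfl, h0⟩ := Nat.mem_divisorsAntidiagonal.1 hx
    rw [pairTerm, if_pos hn, toArith_apply _ (left_ne_zero_of_mul h0),
      toArith_apply _ (right_ne_zero_of_mul h0), MonoidHom.pow_apply]
  · refine (tsum_congr fun x => ?_).trans tsum_zero
    have hx : x.1.1 * x.1.2 = n := x.2
    rw [pairTerm, hx, if_neg hn]

variable {c : ℕ →* ℂ} {s : ℂ}

theorem norm_pairTerm_le (hc : ∀ n, ‖c n‖ ≤ 1) (x : ℕ × ℕ) :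
    ‖pairTerm c s x‖ ≤ (x.1 : ℝ) ^ (-s.re) * (x.2 : ℝ) ^ (-s.re) := by
  rw [pairTerm]
  split_ifs with h
  · rw [norm_mul, norm_mul, norm_pow, Complex.norm_natCast_cpow_of_pos (Nat.pos_of_ne_zero h.ne_zero),
      Complex.neg_re, ← Real.mul_rpow (by positivity) (by positivity), Nat.cast_mul]
    refine mul_le_of_le_one_left (by positivity) ?_
    exact mul_le_one₀ (hc _) (by positivity) (pow_le_one₀ (norm_nonneg _) (hc _))
  · rw [norm_zero]
    positivity

theorem summable_norm_pairTerm (hc : ∀ n, ‖c n‖ ≤ 1) (hs : 1 < s.re) :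
    Summable fun x => ‖pairTerm c s x‖ := by
  have h1 : Summable fun n : ℕ => (n : ℝ) ^ (-s.re) := Real.summable_nat_rpow.2 (by linarith)
  exact Summable.of_nonneg_of_le (fun _ => norm_nonneg _) (norm_pairTerm_le hc)
    (h1.mul_of_nonneg h1 (fun n => by positivity) (fun n => by positivity))

theorem hasSum_collectedTerm (hc : ∀ n, ‖c n‖ ≤ 1) (hs : 1 < s.re) :
    HasSum (collectedTerm c s) (∑' x, pairTerm c s x) := by
  have := (summable_norm_pairTerm hc hs).of_norm.hasSum.tsum_fiberwise
    (fun x : ℕ × ℕ => x.1 * x.2)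
  simpa only [tsum_fiber_pairTerm] using this

theorem summable_norm_collectedTerm (hc : ∀ n, ‖c n‖ ≤ 1) (hs : 1 < s.re) :
    Summable fun n => ‖collectedTerm c s n‖ := by
  have h := summable_norm_pairTerm hc hs
  refine Summable.of_nonneg_of_le (fun _ => norm_nonneg _) (fun n => ?_)
    (h.hasSum.tsum_fiberwise (fun x : ℕ × ℕ => x.1 * x.2)).summable
  rw [← tsum_fiber_pairTerm]
  exact norm_tsum_le_tsum_norm (h.subtype _)

/-- The coefficient at a squarefree `n` is the Dirichlet convolution of `c` and `c²`, hence
multiplicative. -/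
theorem collectedTerm_mul {m n : ℕ} (h : m.Coprime n) :
    collectedTerm c s (m * n) = collectedTerm c s m * collectedTerm c s n := by
  have hm := (isMultiplicative_toArith c).mul (isMultiplicative_toArith (c ^ 2))
  simp only [collectedTerm, Nat.squarefree_mul h]
  by_cases h1 : Squarefree m <;> by_cases h2 : Squarefree n <;> simp only [h1, h2, and_true, and_false,
    if_true, if_false, mul_zero, zero_mul]
  rw [hm.map_mul_of_coprime h, Nat.cast_mul, Complex.natCast_mul_natCast_cpow]
  ring

/-- Only the exponents `0` and `1` are squarefree; at `p` the pairs `(p, 1)` and `(1, p)`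
contribute. -/
theorem tsum_collectedTerm_pow {p : ℕ} (hp : p.Prime) :
    ∑' e, collectedTerm c s (p ^ e) = 1 + (c p + c p ^ 2) * (p : ℂ) ^ (-s) := by
  rw [tsum_eq_sum (s := Finset.range 2)]
  · rw [Finset.sum_range_succ, Finset.sum_range_one, pow_zero, pow_one]
    have h1 : collectedTerm c s 1 = 1 := by simp [collectedTerm, toArith_apply]
    rw [h1, collectedTerm, if_pos hp.prime.squarefree, ArithmeticFunction.mul_apply,
      Nat.sum_divisorsAntidiagonal (fun i j => toArith c i * toArith (c ^ 2) j), hp.sum_divisors,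
      Nat.div_self hp.pos, Nat.div_one]
    simp only [toArith_apply _ hp.ne_zero, toArith_apply _ one_ne_zero, map_one, one_mul, mul_one,
      MonoidHom.pow_apply]
  · intro e he
    have he' : 2 ≤ e := by simpa [Nat.succ_le_iff] using he
    rw [collectedTerm, if_neg]
    intro h
    exact hp.not_isUnit (h p (by rw [← sq]; exact pow_dvd_pow p he'))

theorem hasProd_pairTerm (hc : ∀ n, ‖c n‖ ≤ 1) (hs : 1 < s.re) :
    HasProd (fun p : Nat.Primes => 1 + (c p + c p ^ 2) * ((p : ℕ) : ℂ) ^ (-s))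
      (∑' x, pairTerm c s x) := by
  have h := EulerProduct.eulerProduct_hasProd (f := collectedTerm c s)
    (by simp [collectedTerm, toArith_apply]) (fun h => collectedTerm_mul h)
    (summable_norm_collectedTerm hc hs) (by simp [collectedTerm])
  rw [(hasSum_collectedTerm hc hs).tsum_eq] at h
  have hfun : (fun p : Nat.Primes => ∑' e, collectedTerm c s ((p : ℕ) ^ e)) =
      fun p : Nat.Primes => 1 + (c p + c p ^ 2) * ((p : ℕ) : ℂ) ^ (-s) :=
    funext fun p => tsum_collectedTerm_pow p.2
  rwa [hfun] at h

end DirichletSeries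

/-! ### Cubic characters modulo `9`. -/

section CubicCharacter

/-- The residues modulo `9` prime to `3` as powers of `2` times `±1`: the exponent modulo `3`. -/
def cubicIndex (x : ZMod 9) : ℕ :=
  if x = 1 ∨ x = -1 then 0 else if x = 2 ∨ x = -2 then 1 else 2

/-- The character modulo `9` that is trivial on `±1` and sends `2` to `z`, where `z³ = 1`. -/
noncomputable def cubicChar (z : ℂ) (hz : z ^ 3 = 1) : ℕ →* ℂ where
  -- The condition says `3 ∣ n`. For `z = 1` this is the principal character.
  toFun n := if 3 * (n : ZMod 9) = 0 then 0 else z ^ cubicIndex n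
  map_one' := by
    rw [if_neg (by decide)]
    simp [cubicIndex]
  map_mul' m n := by
    have h1 : ∀ x y : ZMod 9, 3 * (x * y) = 0 ↔ 3 * x = 0 ∨ 3 * y = 0 := by decide
    have h2 : ∀ x y : ZMod 9, ¬ 3 * x = 0 → ¬ 3 * y = 0 →
        cubicIndex (x * y) % 3 = (cubicIndex x + cubicIndex y) % 3 := by decide
    push_cast
    by_cases hm : 3 * (m : ZMod 9) = 0
    · rw [if_pos hm, if_pos ((h1 _ _).2 (.inl hm)), zero_mul]
    by_cases hn : 3 * (n : ZMod 9) = 0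
    · rw [if_pos hn, if_pos ((h1 _ _).2 (.inr hn)), mul_zero]
    rw [if_neg hm, if_neg hn, if_neg (by rw [h1]; tauto), ← pow_add,
      pow_eq_pow_mod (cubicIndex (m * n)) hz, h2 _ _ hm hn, ← pow_eq_pow_mod _ hz]

theorem cubicChar_apply (z : ℂ) (hz : z ^ 3 = 1) (n : ℕ) :
    cubicChar z hz n = if 3 * (n : ZMod 9) = 0 then 0 else z ^ cubicIndex n := rfl

theorem norm_cubicChar_le (z : ℂ) (hz : z ^ 3 = 1) (n : ℕ) : ‖cubicChar z hz n‖ ≤ 1 := by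
  rw [cubicChar_apply]
  split_ifs
  · simp
  · rw [norm_pow, Complex.norm_eq_one_of_pow_eq_one hz three_ne_zero, one_pow]

/-- Orthogonality for the group `(ℤ/9)ˣ/±1` of order `3`. -/
theorem sum_cubicChar {z : ℂ} (hz : z ^ 2 + z + 1 = 0) (h1 : (1 : ℂ) ^ 3 = 1) (h2 : z ^ 3 = 1)
    (h3 : (z ^ 2) ^ 3 = 1) (n : ℕ) :
    cubicChar 1 h1 n + cubicChar z h2 n + cubicChar (z ^ 2) h3 n =
      if (n : ZMod 9) = 1 ∨ (n : ZMod 9) = -1 then 3 else 0 := by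
  simp only [cubicChar_apply]
  generalize (n : ZMod 9) = x
  by_cases hx : 3 * x = 0
  · have : ∀ x : ZMod 9, 3 * x = 0 → ¬ (x = 1 ∨ x = -1) := by decide
    simp [hx, this x hx]
  simp only [if_neg hx, cubicIndex]
  split_ifs
  · norm_num
  · linear_combination hz
  · linear_combination (z ^ 2 - z + 1) * hz

theorem cubicChar_one_add_sq (h1 : (1 : ℂ) ^ 3 = 1) (n : ℕ) :
    cubicChar 1 h1 n + cubicChar 1 h1 n ^ 2 = if 3 * (n : ZMod 9) = 0 then 0 else 2 := by
  rw [cubicChar_apply]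
  split_ifs <;> norm_num

theorem cubicChar_add_sq {z : ℂ} (hz : z ^ 2 + z + 1 = 0) (h2 : z ^ 3 = 1) (n : ℕ) :
    cubicChar z h2 n + cubicChar z h2 n ^ 2 =
      if 3 * (n : ZMod 9) = 0 then 0 else if (n : ZMod 9) = 1 ∨ (n : ZMod 9) = -1 then 2 else -1 := by
  rw [cubicChar_apply, cubicIndex]
  split_ifs
  · norm_num
  · norm_num
  · linear_combination hz
  · linear_combination hz + z * h2

theorem three_mul_natCast_eq_zero_iff {p : ℕ} (hp : p.Prime) : 3 * (p : ZMod 9) = 0 ↔ p = 3 := by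
  have : (3 : ZMod 9) * p = ((3 * p : ℕ) : ZMod 9) := by push_cast; rfl
  rw [this, ZMod.natCast_eq_zero_iff, show 9 = 3 * 3 from rfl, Nat.mul_dvd_mul_iff_left (by norm_num),
    Nat.prime_dvd_prime_iff_eq Nat.prime_three hp, eq_comm]

end CubicCharacter

end PureCubic

namespace PureCubic

/-! ### Evaluation of the Euler products. -/

section EulerProducts

variable {s : ℂ}

theorem summable_primes_norm_mul_cpow {u : Nat.Primes → ℂ} (hu : ∀ p, ‖u p‖ ≤ 2) (hs : 1 < s.re) :
    Summable fun p : Nat.Primes => ‖u p * ((p : ℕ) : ℂ) ^ (-s)‖ := by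
  refine Summable.of_nonneg_of_le (fun _ => norm_nonneg _) (fun p => ?_)
    ((Nat.Primes.summable_rpow.2 (show -s.re < -1 by linarith)).mul_left 2)
  rw [norm_mul, Complex.norm_natCast_cpow_of_pos p.2.pos, Complex.neg_re]
  exact mul_le_mul_of_nonneg_right (hu p) (by positivity)

theorem multipliable_subtype_one_add {u : Nat.Primes → ℂ} (hu : ∀ p, ‖u p‖ ≤ 2) (hs : 1 < s.re)
    (S : Set Nat.Primes) :
    Multipliable fun p : S => 1 + u p * ((p : ℕ) : ℂ) ^ (-s) :=
  multipliable_one_add_of_summable ((summable_primes_norm_mul_cpow hu hs).subtype S)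

theorem div_natCast_cpow (n : ℕ) (x : ℂ) : x / (n : ℂ) ^ s = x * (n : ℂ) ^ (-s) := by
  rw [Complex.cpow_neg, div_eq_mul_inv]

/-- The primes `p ≠ 3`. -/
def primesNeThree : Set Nat.Primes := {p | (p : ℕ) ≠ 3}

/-- The primes `p` with `p ≡ ±1 (mod 9)`. -/
def splitPrimes : Set Nat.Primes := {p | ((p : ℕ) : ZMod 9) = 1 ∨ ((p : ℕ) : ZMod 9) = -1}

theorem multipliable_ne_three (hs : 1 < s.re) :
    Multipliable fun p : primesNeThree => 1 + 2 / ((p : ℕ) : ℂ) ^ s := by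
  simp only [div_natCast_cpow]
  exact multipliable_subtype_one_add (u := fun _ => 2) (by simp) hs primesNeThree

theorem multipliable_split (hs : 1 < s.re) :
    Multipliable fun p : splitPrimes => 1 + 2 / ((p : ℕ) : ℂ) ^ s := by
  simp only [div_natCast_cpow]
  exact multipliable_subtype_one_add (u := fun _ => 2) (by simp) hs splitPrimes

theorem multipliable_not_split (hs : 1 < s.re) :
    Multipliable fun p : ↑(splitPrimesᶜ) => 1 - 1 / ((p : ℕ) : ℂ) ^ s := by
  have := multipliable_subtype_one_add (u := fun _ => -1) (by simp) hs splitPrimesᶜ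
  simpa only [div_natCast_cpow, sub_eq_add_neg, neg_mul] using this

/-- The prime `3`. -/
def primeThree : Nat.Primes := ⟨3, Nat.prime_three⟩

theorem eq_primeThree_iff {p : Nat.Primes} : p = primeThree ↔ (p : ℕ) = 3 := Subtype.ext_iff

theorem tsum_pairTerm_principal (h1 : (1 : ℂ) ^ 3 = 1) (hs : 1 < s.re) :
    ∑' x, pairTerm (cubicChar 1 h1) s x =
      ∏' p : primesNeThree, (1 + 2 / ((p : ℕ) : ℂ) ^ s) := by
  refine (HasProd.tprod_eq ?_).symm
  have h := hasProd_pairTerm (norm_cubicChar_le 1 h1) hs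
  rw [← hasProd_subtype_iff_of_mulSupport_subset (s := primesNeThree)] at h
  · refine (congrArg (HasProd · _) (funext fun p => ?_)).mp h
    have hp : ((p : Nat.Primes) : ℕ) ≠ 3 := p.2
    simp only [Function.comp_apply]
    rw [cubicChar_one_add_sq, if_neg (mt (three_mul_natCast_eq_zero_iff p.1.2).1 hp),
      div_natCast_cpow]
    rfl
  · intro p hp hp3
    refine hp ?_
    beta_reduce
    rw [cubicChar_one_add_sq, if_pos ((three_mul_natCast_eq_zero_iff p.2).2 hp3), zero_mul, add_zero]

/-- The constant function `1` differs from the principal character only in the Euler factor at `3`.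
-/
theorem tsum_pairTerm_one (hs : 1 < s.re) :
    ∑' x, pairTerm 1 s x = (1 + 2 * (3 : ℂ) ^ (-s)) *
      ∏' p : primesNeThree, (1 + 2 / ((p : ℕ) : ℂ) ^ s) := by
  have h1 : (1 : ℂ) ^ 3 = 1 := one_pow 3
  rw [← tsum_pairTerm_principal h1 hs, mul_comm]
  refine HasProd.unique (hasProd_pairTerm (c := 1) (by simp) hs) ?_
  convert (hasProd_pairTerm (norm_cubicChar_le 1 h1) hs).mul
    (hasProd_ite_eq primeThree (1 + 2 * (3 : ℂ) ^ (-s))) using 2 with p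
  rw [cubicChar_one_add_sq]
  simp only [three_mul_natCast_eq_zero_iff p.2, eq_primeThree_iff]
  split_ifs with hp
  · rw [hp]
    norm_num
  · norm_num

/-- The character vanishes at `3`, while the second product on the right has a factor there; `1 -
3^(-s)` compensates. The value does not depend on the choice of `z`. -/
theorem tsum_pairTerm_cubicChar {z : ℂ} (hz : z ^ 2 + z + 1 = 0) (h2 : z ^ 3 = 1) (hs : 1 < s.re) :
    (1 - (3 : ℂ) ^ (-s)) * ∑' x, pairTerm (cubicChar z h2) s x =
      (∏' p : splitPrimes, (1 + 2 / ((p : ℕ) : ℂ) ^ s)) *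
        ∏' p : ↑(splitPrimesᶜ), (1 - 1 / ((p : ℕ) : ℂ) ^ s) := by
  classical
  rw [mul_comm]
  let f : Nat.Primes → ℂ := fun p =>
    if p ∈ splitPrimes then 1 + 2 / ((p : ℕ) : ℂ) ^ s else 1 - 1 / ((p : ℕ) : ℂ) ^ s
  have hA : HasProd (f ∘ ((↑) : splitPrimes → Nat.Primes))
      (∏' p : splitPrimes, (1 + 2 / ((p : ℕ) : ℂ) ^ s)) := by
    convert (multipliable_split hs).hasProd using 2 with p
    exact if_pos p.2
  have hB : HasProd (f ∘ ((↑) : ↑(splitPrimesᶜ) → Nat.Primes))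
      (∏' p : ↑(splitPrimesᶜ), (1 - 1 / ((p : ℕ) : ℂ) ^ s)) := by
    convert (multipliable_not_split hs).hasProd using 2 with p
    exact if_neg p.2
  refine HasProd.unique ?_ (hA.mul_compl hB)
  convert (hasProd_pairTerm (norm_cubicChar_le z h2) hs).mul
    (hasProd_ite_eq primeThree (1 - (3 : ℂ) ^ (-s))) using 2 with p
  rw [cubicChar_add_sq hz]
  simp only [three_mul_natCast_eq_zero_iff p.2, eq_primeThree_iff, f, div_natCast_cpow]
  by_cases hp : (p : ℕ) = 3
  · have hns : p ∉ splitPrimes := by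
      change ¬ (((p : ℕ) : ZMod 9) = 1 ∨ ((p : ℕ) : ZMod 9) = -1)
      rw [hp]
      decide
    rw [if_neg hns, if_pos hp, if_pos hp, hp]
    norm_num
  · rw [if_neg hp, if_neg hp]
    by_cases hsp : p ∈ splitPrimes
    · have hsp' : ((p : ℕ) : ZMod 9) = 1 ∨ ((p : ℕ) : ZMod 9) = -1 := hsp
      rw [if_pos hsp, if_pos hsp', mul_one]
    · have hsp' : ¬ (((p : ℕ) : ZMod 9) = 1 ∨ ((p : ℕ) : ZMod 9) = -1) := hsp
      rw [if_neg hsp, if_neg hsp']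
      ring

end EulerProducts

/-! ### The Dirichlet series over radicands. -/

section RadicandSeries

variable {s : ℂ}

theorem natCast_zmod_nine_eq_iff (n : ℕ) :
    ((n : ZMod 9) = 1 ∨ (n : ZMod 9) = -1) ↔ (n % 9 = 1 ∨ n % 9 = 8) := by
  have h1 : (n : ZMod 9) = 1 ↔ n % 9 = 1 := by
    simpa using ZMod.natCast_eq_natCast_iff' n 1 9
  have h2 : (n : ZMod 9) = -1 ↔ n % 9 = 8 := by
    have := ZMod.natCast_eq_natCast_iff' n 8 9
    rwa [show ((8 : ℕ) : ZMod 9) = -1 by decide] at this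
  rw [h1, h2]

/-- The term is `(ab)^(-s) (3^(-s) + (1 - 3^(-s)) δ)`, where `δ` indicates `ab² ≡ ±1 (mod 9)` and is
a third of the character sum at `ab²`. -/
theorem one_div_radicandConductor_cpow {z : ℂ} (hz : z ^ 2 + z + 1 = 0) (h1 : (1 : ℂ) ^ 3 = 1)
    (h2 : z ^ 3 = 1) (h3 : (z ^ 2) ^ 3 = 1) (x : ℕ × ℕ) :
    (if Squarefree (x.1 * x.2) then 1 / (radicandConductor x.1 x.2 : ℂ) ^ s else 0) =
      (3 : ℂ) ^ (-s) * pairTerm 1 s x + (1 - (3 : ℂ) ^ (-s)) / 3 *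
        (pairTerm (cubicChar 1 h1) s x + pairTerm (cubicChar z h2) s x +
          pairTerm (cubicChar (z ^ 2) h3) s x) := by
  simp only [pairTerm]
  split_ifs with hx
  · have hsum := sum_cubicChar hz h1 h2 h3 (x.1 * x.2 ^ 2)
    simp only [map_mul, map_pow, natCast_zmod_nine_eq_iff] at hsum
    rw [← add_mul, ← add_mul, hsum, div_natCast_cpow, radicandConductor]
    split_ifs with h9
    · simp only [MonoidHom.one_apply]
      ring
    · rw [Nat.cast_mul 3, Complex.natCast_mul_natCast_cpow]
      simp only [MonoidHom.one_apply, Nat.cast_ofNat]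
      ring
  · simp

/-- The pairs `(a, b)` that parametrize pure cubic fields. -/
def radicands : Set (ℕ × ℕ) := {x | IsRadicand x.1 x.2}

theorem hasSum_radicands (hs : 1 < s.re) :
    HasSum (fun x : radicands =>
        1 / (radicandConductor x.1.1 x.1.2 : ℂ) ^ s)
      (2 * (-1 / 2 +
          1 / 6 * (1 + 2 / (3 : ℂ) ^ s + 6 / (3 : ℂ) ^ (2 * s)) *
            (∏' p : primesNeThree, (1 + 2 / ((p : ℕ) : ℂ) ^ s)) +
          1 / 3 *
            (∏' p : splitPrimes, (1 + 2 / ((p : ℕ) : ℂ) ^ s)) *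
            (∏' p : ↑(splitPrimesᶜ), (1 - 1 / ((p : ℕ) : ℂ) ^ s)))) := by
  classical
  obtain ⟨z, hz⟩ : ∃ z : ℂ, z ^ 2 + z + 1 = 0 := by
    have h := Complex.isPrimitiveRoot_exp 3 three_ne_zero
    have := Polynomial.isRoot_cyclotomic_iff.2 h
    exact ⟨_, by simpa [Polynomial.cyclotomic_three] using this⟩
  have h1 : (1 : ℂ) ^ 3 = 1 := one_pow 3
  have h2 : z ^ 3 = 1 := by linear_combination (z - 1) * hz
  have h3 : (z ^ 2) ^ 3 = 1 := by rw [← pow_mul, mul_comm, pow_mul, h2, one_pow]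
  have hz2 : (z ^ 2) ^ 2 + z ^ 2 + 1 = 0 := by linear_combination (z ^ 2 - z + 1) * hz
  have hsum : ∀ {c : ℕ →* ℂ}, (∀ n, ‖c n‖ ≤ 1) → HasSum (pairTerm c s) (∑' x, pairTerm c s x) :=
    fun hc => (summable_norm_pairTerm hc hs).of_norm.hasSum
  have key := ((hsum (c := 1) (by simp)).mul_left ((3 : ℂ) ^ (-s))).add
    ((((hsum (norm_cubicChar_le 1 h1)).add (hsum (norm_cubicChar_le z h2))).add
      (hsum (norm_cubicChar_le (z ^ 2) h3))).mul_left ((1 - (3 : ℂ) ^ (-s)) / 3))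
  simp only [← one_div_radicandConductor_cpow hz h1 h2 h3] at key
  -- The pair `(1, 1)` gives no field; its term is `1`.
  have key2 := key.sub (hasSum_ite_eq ((1, 1) : ℕ × ℕ) (1 : ℂ))
  rw [← hasSum_subtype_iff_of_support_subset (s := radicands)] at key2
  · have hfun : (fun x : radicands => 1 / (radicandConductor x.1.1 x.1.2 : ℂ) ^ s) =
        (fun x : ℕ × ℕ => (if Squarefree (x.1 * x.2) then 1 / (radicandConductor x.1 x.2 : ℂ) ^ s
          else 0) - if x = (1, 1) then 1 else 0) ∘ ((↑) : radicands → ℕ × ℕ) := by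
      funext x
      have hx : IsRadicand x.1.1 x.1.2 := x.2
      have hne : x.1 ≠ (1, 1) := fun h => hx.2 (by simp [h])
      rw [Function.comp_apply, if_pos hx.1, if_neg hne, sub_zero]
    rw [hfun]
    refine (congrArg (HasSum _) ?_).mp key2
    have e1 := tsum_pairTerm_cubicChar hz h2 hs
    have e2 := tsum_pairTerm_cubicChar hz2 h3 hs
    rw [tsum_pairTerm_one hs, tsum_pairTerm_principal h1 hs]
    have e3 : (3 : ℂ) ^ (2 * s) = ((3 : ℂ) ^ s) ^ 2 := by
      rw [mul_comm, Complex.cpow_mul_ofNat]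
    rw [e3, div_eq_mul_inv 2, div_eq_mul_inv 6, ← inv_pow, ← Complex.cpow_neg]
    linear_combination (e1 + e2) / 3
  · intro x hx
    by_contra hn
    refine hx ?_
    by_cases h11 : x = (1, 1)
    · subst h11
      simp [radicandConductor]
    · have hsq : ¬ Squarefree (x.1 * x.2) := fun h => hn ⟨h, fun h' => h11 (Prod.ext h'.1 h'.2)⟩
      simp [hsq, h11]

end RadicandSeries

end PureCubic

/-! ### From radicands to isomorphism classes. -/

namespace PureCubic

theorem exists_pureCubicField {a b : ℕ} (h : IsRadicand a b) :
    ∃ (K : PureCubicField) (η : K.1), η ^ 3 = a * b ^ 2 := by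
  obtain ⟨θ, hθ⟩ := IsAlgClosed.exists_pow_nat_eq ((a : AlgebraicClosure ℚ) * b ^ 2) three_pos
  let K : IntermediateField ℚ (AlgebraicClosure ℚ) := IntermediateField.adjoin ℚ {θ}
  have hη : (⟨θ, IntermediateField.mem_adjoin_simple_self ℚ θ⟩ : K) ^ 3 = a * b ^ 2 :=
    Subtype.ext (by simpa using hθ)
  have hd : Module.finrank ℚ (IntermediateField.adjoin ℚ {θ}) = 3 :=
    finrank_adjoin_of_cube_eq (m := a * b ^ 2) h.cube_ne (by simpa using hθ)
  refine ⟨⟨K, isPureCubic_of_cube_eq ?_ h hη⟩, _, hη⟩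
  convert hd

/-- The isomorphism class of the field generated by a cube root of `a * b ^ 2`. -/
noncomputable def radicandClass (x : radicands) : PureCubicClass :=
  ⟦(exists_pureCubicField x.2).choose⟧

theorem radicandClass_eq_iff (x : radicands) (K : PureCubicField) :
    radicandClass x = ⟦K⟧ ↔ ∃ η : K.1, η ^ 3 = x.1.1 * x.1.2 ^ 2 := by
  obtain ⟨η, hη⟩ := (exists_pureCubicField x.2).choose_spec
  constructor
  · intro h
    obtain ⟨e⟩ := Quotient.exact h
    exact ⟨e η, by rw [← map_pow, hη]; simp⟩
  · rintro ⟨η', hη'⟩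
    refine Quotient.sound ?_
    refine nonempty_algEquiv_of_cube_eq (m := x.1.1 * x.1.2 ^ 2)
      (exists_pureCubicField x.2).choose.2.1 K.2.1 (IsRadicand.cube_ne x.2)
      (η := η) (η' := η') ?_ ?_
    · rw [hη, algebraMap_radicand]
    · rw [hη', algebraMap_radicand]

theorem classConductor_radicandClass (x : radicands) :
    classConductor (radicandClass x) = radicandConductor x.1.1 x.1.2 := by
  obtain ⟨η, hη⟩ := (exists_pureCubicField x.2).choose_spec
  exact cubicConductor_eq (exists_pureCubicField x.2).choose.2.1 x.2 hη

theorem isCubicConductor_cubicConductor (K : PureCubicField) :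
    IsCubicConductor K.1 (cubicConductor K.1) := by
  obtain ⟨a, b, hab, η, hη⟩ := exists_isRadicand_of_isPureCubic K.2
  exact (isCubicConductor_iff K.2.1 hab hη _).2 (cubicConductor_eq K.2.1 hab hη)

/-- The fibre is `{(a, b), (b, a)}`, and `a ≠ b` because `ab` is squarefree and `(a, b) ≠ (1, 1)`.
-/
theorem card_radicandClass_fiber (c : PureCubicClass) :
    Nat.card {x : radicands // radicandClass x = c} = 2 := by
  induction c using Quotient.inductionOn with | _ K
  obtain ⟨a, b, hab, η, hη⟩ := exists_isRadicand_of_isPureCubic K.2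
  obtain ⟨η', hη'⟩ := exists_cube_eq_symm hab hη
  have hcoe : {x : radicands | radicandClass x = ⟦K⟧}.ncard = 2 := by
    rw [Set.ncard_eq_two]
    refine ⟨⟨(a, b), hab⟩, ⟨(b, a), hab.symm⟩, ?_, ?_⟩
    · intro h
      exact hab.ne (congrArg (fun x : radicands => x.1.1) h)
    · ext x
      rw [Set.mem_insert_iff, Set.mem_singleton_iff]
      refine (radicandClass_eq_iff x K).trans ⟨?_, ?_⟩
      · rintro ⟨ξ, hξ⟩
        rcases eq_or_eq_symm_of_cube_eq K.2.1 hab x.2 hη hξ with h | h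
        · exact .inl (Subtype.ext (Prod.ext h.1.symm h.2.symm))
        · exact .inr (Subtype.ext (Prod.ext h.1.symm h.2.symm))
      · rintro (rfl | rfl)
        exacts [⟨η, hη⟩, ⟨η', hη'⟩]
  rwa [← Nat.card_coe_set_eq] at hcoe

/-- Summing first over the fibres counts each `g c` exactly `n` times. -/
theorem hasSum_of_comp_of_card_fiber {α β : Type*} {φ : α → β} {n : ℕ} (hn : n ≠ 0)
    (hφ : ∀ c, Nat.card {x // φ x = c} = n) {g : β → ℂ} {t : ℂ} (h : HasSum (g ∘ φ) (n * t)) :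
    HasSum g t := by
  rw [← (Equiv.sigmaFiberEquiv φ).hasSum_iff] at h
  have hfib : ∀ c, HasSum
      (fun x : {x // φ x = c} => ((g ∘ φ) ∘ Equiv.sigmaFiberEquiv φ) ⟨c, x⟩) (n * g c) := by
    intro c
    have : Finite {x // φ x = c} := Nat.finite_of_card_ne_zero (by rwa [hφ])
    have := Fintype.ofFinite {x // φ x = c}
    have hc := hasSum_fintype fun _ : {x // φ x = c} => g c
    rw [Finset.sum_const, Finset.card_univ, ← Nat.card_eq_fintype_card, hφ, nsmul_eq_mul] at hc
    refine (congrArg (HasSum · _) (funext fun x => ?_)).mp hc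
    exact congrArg g x.2.symm
  have hn' : (n : ℂ) ≠ 0 := Nat.cast_ne_zero.2 hn
  simpa [hn'] using (h.sigma hfib).mul_left (n : ℂ)⁻¹

theorem hasSum_classConductor {s t : ℂ}
    (h : HasSum (fun x : radicands => 1 / (radicandConductor x.1.1 x.1.2 : ℂ) ^ s) (2 * t)) :
    HasSum (fun K : PureCubicClass => 1 / (classConductor K : ℂ) ^ s) t := by
  refine hasSum_of_comp_of_card_fiber (φ := radicandClass) two_ne_zero card_radicandClass_fiber ?_
  rw [Nat.cast_ofNat]
  refine (congrArg (HasSum · _) (funext fun x => ?_)).mp h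
  simp only [Function.comp_apply, classConductor_radicandClass]

end PureCubic

theorem proposition7p3 :
    (∀ K : PureCubic.PureCubicField,
      PureCubic.IsCubicConductor K.1 (PureCubic.cubicConductor K.1)) ∧
    ∀ s : ℂ, 1 < s.re →
      Multipliable (fun p : {p : Nat.Primes // (p : ℕ) ≠ 3} =>
        1 + 2 / ((p : ℕ) : ℂ) ^ s) ∧
      Multipliable (fun p : {p : Nat.Primes // ((p : ℕ) : ZMod 9) = 1 ∨ ((p : ℕ) : ZMod 9) = -1} =>
        1 + 2 / ((p : ℕ) : ℂ) ^ s) ∧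
      Multipliable
        (fun p : {p : Nat.Primes // ¬(((p : ℕ) : ZMod 9) = 1 ∨ ((p : ℕ) : ZMod 9) = -1)} =>
          1 - 1 / ((p : ℕ) : ℂ) ^ s) ∧
      HasSum (fun K : PureCubic.PureCubicClass => 1 / (PureCubic.classConductor K : ℂ) ^ s)
        (-1 / 2 +
          1 / 6 * (1 + 2 / (3 : ℂ) ^ s + 6 / (3 : ℂ) ^ (2 * s)) *
            (∏' p : {p : Nat.Primes // (p : ℕ) ≠ 3}, (1 + 2 / ((p : ℕ) : ℂ) ^ s)) +
          1 / 3 *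
            (∏' p : {p : Nat.Primes // ((p : ℕ) : ZMod 9) = 1 ∨ ((p : ℕ) : ZMod 9) = -1},
              (1 + 2 / ((p : ℕ) : ℂ) ^ s)) *
            (∏' p : {p : Nat.Primes // ¬(((p : ℕ) : ZMod 9) = 1 ∨ ((p : ℕ) : ZMod 9) = -1)},
              (1 - 1 / ((p : ℕ) : ℂ) ^ s))) := by
  refine ⟨PureCubic.isCubicConductor_cubicConductor, fun s hs => ⟨PureCubic.multipliable_ne_three hs,
    PureCubic.multipliable_split hs, PureCubic.multipliable_not_split hs,
    PureCubic.hasSum_classConductor (PureCubic.hasSum_radicands hs)⟩⟩
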